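/- Let $q$ be an odd prime power and let $B\subset\mathbb P^2$ be the Ballico–Hefez curve over $\mathbb F_q$, that is, the image of the morphism $$\mathbb P^1\to\mathbb P^2,\qquad (s:t)\mapsto (s^{q+1}: s^{q}t+st^{q}: t^{q+1})$$ (over an algebraic closure $\overline{\mathbb F}_q$), and let $B(\mathbb F_q)$ be the set of points of $\mathbb P^2(\mathbb F_q)$ that lie on $B$. For each $P\in B(\mathbb F_q)$ fix a coordinate vector of $P$ in $\mathbb F_q^3\setminus\{0\}$; for a homogeneous polynomial $F\in\mathbb F_q[X_0,X_1,X_2]$ let $F(P)$ be the value of $F$ at that vector. For $i\ge 1$ let $C_L(B(\mathbb F_q),\mathcal O(i))\subset \mathbb F_q^{\,B(\mathbb F_q)}$ be the linear code $\{(F(P))_{P\in B(\mathbb F_q)}\}$, where $F$ runs over the homogeneous polynomials of degree $i$ over $\mathbb F_q$ (together with $0$). An $[n,k,d]_q$ code is a linear code over $\mathbb F_q$ of length $n$, dimension $k$ and minimum (Hamming) distance exactly $d$; it meets the Griesmer bound if $n=\sum_{j=0}^{k-1}\lceil d/q^j\rceil$. Then, for every choice of the coordinate vectors: 1. $C_L(B(\mathbb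 F_q),\mathcal O(1))$ is a $\left[\frac{q^2+q+2}{2},\,3,\,\frac{q^2-1}{2}\right]_q$ code, and it meets the Griesmer bound. 2. If $q\ge 5$, then $C_L(B(\mathbb F_q),\mathcal O(2))$ is a $\left[\frac{q^2+q+2}{2},\,6,\,\frac{q^2-q-4}{2}\right]_q$ code. 3. If $q\ge 7$, then $C_L(B(\mathbb F_q),\mathcal O(3))$ is a $\left[\frac{q^2+q+2}{2},\,10,\,\frac{q^2-2q-7}{2}\right]_q$ code. -/

import Mathlib

open scoped LinearAlgebra.Projectivization

namespace BallicoHefez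

/-- The triple `(s^(q+1), s^q t + s t^q, t^(q+1))`, for `v = (s, t)`. -/
def coords {L : Type*} [Field L] (q : ℕ) (v : Fin 2 → L) : Fin 3 → L :=
  ![v 0 ^ (q + 1), v 0 ^ q * v 1 + v 0 * v 1 ^ q, v 1 ^ (q + 1)]

theorem coords_ne_zero {L : Type*} [Field L] (q : ℕ) {v : Fin 2 → L} (hv : v ≠ 0) :
    coords q v ≠ 0 := by
  intro h
  have h0 : v 0 ^ (q + 1) = 0 := by simpa [coords] using congrFun h 0
  have h2 : v 1 ^ (q + 1) = 0 := by simpa [coords] using congrFun h 2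
  apply hv
  funext i
  fin_cases i
  · simpa using h0
  · simpa using h2

theorem coords_smul {L : Type*} [Field L] (q : ℕ) (c : L) (v : Fin 2 → L) :
    coords q (c • v) = c ^ (q + 1) • coords q v := by
  funext i
  fin_cases i <;> simp [coords] <;> ring

/-- The morphism `(s : t) ↦ (s^(q+1) : s^q t + s t^q : t^(q+1))` from the projective line to the
projective plane, on points with coordinates in the field `L`. -/
def morphism (L : Type*) [Field L] (q : ℕ) : ℙ L (Fin 2 → L) → ℙ L (Fin 3 → L) :=
  Projectivization.lift (fun v => Projectivization.mk L (coords q v.1) (coords_ne_zero q v.2))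
    (by
      rintro ⟨a, ha⟩ ⟨b, hb⟩ t h
      change a = t • b at h
      rw [Projectivization.mk_eq_mk_iff']
      exact ⟨t ^ (q + 1), by rw [← coords_smul, ← h]⟩)

/-- Extension of scalars `K³ → L³` on coordinate vectors. -/
def extendVec (K L : Type*) [Field K] [Field L] [Algebra K L] :
    (Fin 3 → K) →ₛₗ[algebraMap K L] (Fin 3 → L) where
  toFun v := fun i => algebraMap K L (v i)
  map_add' v w := by funext i; simp
  map_smul' c v := by funext i; simp

theorem extendVec_injective (K L : Type*) [Field K] [Field L] [Algebra K L] :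
    Function.Injective (extendVec K L) := fun _ _ h =>
  funext fun i => (algebraMap K L).injective (congrFun h i)

/-- The inclusion `ℙ²(K) → ℙ²(L)` for a field extension `L / K`. -/
def extendPoint (K L : Type*) [Field K] [Field L] [Algebra K L] :
    ℙ K (Fin 3 → K) → ℙ L (Fin 3 → L) :=
  Projectivization.map (extendVec K L) (extendVec_injective K L)

/-- The Ballico-Hefez curve over the finite field `K` with `q` elements, as the set of its
geometric points: the image of the projective line over the algebraic closure. -/
def curve (K : Type*) [Field K] [Fintype K] :
    Set (ℙ (AlgebraicClosure K) (Fin 3 → AlgebraicClosure K)) :=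
  Set.range (morphism (AlgebraicClosure K) (Fintype.card K))

/-- The set of `K`-points of the Ballico-Hefez curve: the points of `ℙ²(K)` lying on the curve. -/
def rationalPoints (K : Type*) [Field K] [Fintype K] : Set (ℙ K (Fin 3 → K)) :=
  extendPoint K (AlgebraicClosure K) ⁻¹' curve K

noncomputable instance (K : Type*) [Field K] [Fintype K] : Fintype (rationalPoints K) :=
  Fintype.ofFinite _

end BallicoHefez

/-- A choice of a coordinate vector for every point of a set `S` of points of the plane. -/
def IsRepresentatives {K : Type*} [Field K] {S : Set (ℙ K (Fin 3 → K))}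
    (r : S → {v : Fin 3 → K // v ≠ 0}) : Prop :=
  ∀ P : S, Projectivization.mk K (r P).1 (r P).2 = P.1

/-- The linear map sending `F` to the vector of its values at the points of `S`, computed with the
coordinate vectors `r`. -/
noncomputable def evaluationMap {K : Type*} [Field K] {S : Set (ℙ K (Fin 3 → K))}
    (r : S → {v : Fin 3 → K // v ≠ 0}) : MvPolynomial (Fin 3) K →ₗ[K] (S → K) :=
  LinearMap.pi fun P => (MvPolynomial.aeval (r P).1).toLinearMap

/-- The code `C_L(S, O(i))`: the image of the homogeneous polynomials of degree `i` under
evaluation at the points of `S`, with coordinate vectors `r`. -/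
noncomputable def evaluationCode {K : Type*} [Field K] {S : Set (ℙ K (Fin 3 → K))}
    (r : S → {v : Fin 3 → K // v ≠ 0}) (i : ℕ) : Submodule K (S → K) :=
  (MvPolynomial.homogeneousSubmodule (Fin 3) K i).map (evaluationMap r)

/-- `C` is an `[n, k, d]` code: it has length `n`, dimension `k` and minimum distance `d`. -/
structure IsLinearCode {K ι : Type*} [Field K] [DecidableEq K] [Fintype ι]
    (C : Submodule K (ι → K)) (n k d : ℕ) : Prop where
  length_eq : Fintype.card ι = n
  dim_eq : Module.finrank K C = k
  isLeast_dist : IsLeast {m | ∃ x ∈ C, ∃ y ∈ C, x ≠ y ∧ hammingDist x y = m} d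

/-- The code `C`, over a field with `q` elements, meets the Griesmer bound: its parameters
`[n, k, d]` satisfy `n = ∑_{i < k} ⌈d / q^i⌉`. -/
def MeetsGriesmerBound {K ι : Type*} [Field K] [Fintype K] [DecidableEq K] [Fintype ι]
    (C : Submodule K (ι → K)) : Prop :=
  ∃ n k d : ℕ, IsLinearCode C n k d ∧
    n = ∑ i ∈ Finset.range k, ⌈(d : ℚ) / (Fintype.card K : ℚ) ^ i⌉₊

/-!
The rational points of the curve are described by the discriminant `D = x₁² - 4 x₀ x₂`: a point of
`ℙ²(K)` lies on the curve if and only if `D` is zero or a nonsquare there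
(`mk_mem_rationalPoints_iff`), since `(N(s) : Tr(s) : 1)` is the image of `s ∈ 𝔽_{q²}` and `s`,
`s^q` are the roots of `T² - Tr(s) T + N(s)`. In other words, the rational points are those of the
conic `D = 0` and the points that lie on none of its rational tangents. Summing the quadratic
character gives their number, shows that a line contains at most `(q + 3) / 2` of them
(`two_mul_card_line_le`) and that the lines `x₀ = a² x₂`, `a ≠ 0`, contain exactly this number
(`two_mul_card_secant`). These lines meet in `(0 : 1 : 0)`, which is not on the curve, so that a
product of `i` of them has `i (q + 3) / 2` zeros on it. It remains to see that no nonzero form of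
degree `i ≤ 3` has more; the parameters of the codes then follow (`isLinearCode_evaluationCode`).

A form with a linear factor is dealt with by induction on the degree. A conic without linear
factor has at most `q + 2` rational points, as is seen from the lines through one of them. For a
cubic `F` without linear factor the bound is that of Stöhr and Voloch, `2 N ≤ 3 (q + 2)`
(`two_mul_card_le_of_cubic`): the form `H = ∑ᵢ Xᵢ^q ∂F/∂Xᵢ` of degree `q + 2` vanishes at every
rational point of the cubic, and so does its derivative in the tangent direction
(`jet_frobeniusForm`). If `F` does not divide `H`, the inequality follows from Bézout's theorem in
the form `two_mul_card_le_mul`, whose proof compares the codimension of the ideal `(F, H)` in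
large degree with the number of independent conditions imposed by values and tangential
derivatives.

If a rational point of the cubic is singular, the lines through it give `N ≤ q + 2`. If all are
smooth and `F` divides `H`, then every rational line that is not a tangent meets the cubic in
three distinct rational points, because the restriction `g` of `F` to the line divides
`(t^q - t) g'`. Counting incidences of points and lines then contradicts `N ≤ 2 q + 3` for `q ≥ 7`
(`not_dvd_frobeniusForm`).
-/

namespace BallicoHefez

open scoped Matrix

/-! ### The rational points of the curve -/

section RationalPoints

variable {K : Type*} [Field K]

/-- Zero or a nonsquare: the values of the discriminant at the rational points of the curve. -/
def ZeroOrNonsquare (a : K) : Prop := a = 0 ∨ ¬ IsSquare a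

/-- The discriminant `x₁² - 4 x₀ x₂` of the binary quadratic form `x₂ T² - x₁ T + x₀`. -/
def disc (x : Fin 3 → K) : K := x 1 ^ 2 - 4 * x 0 * x 2

theorem disc_smul (c : K) (x : Fin 3 → K) : disc (c • x) = c ^ 2 * disc x := by
  simp only [disc, Pi.smul_apply, smul_eq_mul]; ring

theorem zeroOrNonsquare_sq_mul {c : K} (hc : c ≠ 0) (a : K) :
    ZeroOrNonsquare (c ^ 2 * a) ↔ ZeroOrNonsquare a := by
  have hsq : IsSquare (c ^ 2 * a) ↔ IsSquare a := by
    constructor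
    · rintro ⟨b, hb⟩
      refine ⟨b / c, ?_⟩
      field_simp
      linear_combination hb
    · rintro ⟨b, hb⟩
      exact ⟨c * b, by rw [hb]; ring⟩
  simp only [ZeroOrNonsquare, hsq, mul_eq_zero, pow_eq_zero_iff, ne_eq, OfNat.ofNat_ne_zero,
    not_false_eq_true, hc, false_or]

theorem zeroOrNonsquare_sq {a : K} : ZeroOrNonsquare (a ^ 2) ↔ a = 0 := by
  simp [ZeroOrNonsquare, IsSquare.sq]

variable [Fintype K]

theorem ringChar_ne_two_of_odd_card (hodd : Odd (Fintype.card K)) : ringChar K ≠ 2 := by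
  intro h1
  have := FiniteField.even_card_of_char_two h1
  rw [Nat.odd_iff] at hodd
  omega

theorem two_ne_zero_of_odd_card (hodd : Odd (Fintype.card K)) : (2 : K) ≠ 0 :=
  Ring.two_ne_zero (ringChar_ne_two_of_odd_card hodd)

/-- If the image of `(s : 1)` is rational, then `D = (s^q - s)²` up to a square factor. As
`s^(q²) = s`, Frobenius changes the sign of `s^q - s`, which therefore is zero or not in `K`. -/
theorem zeroOrNonsquare_disc_of_morphism {L : Type*} [Field L] [Algebra K L]
    (hodd : Odd (Fintype.card K)) {x : Fin 3 → K} {v : Fin 2 → L} {l : L}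
    (hl : l ≠ 0) (h : extendVec K L x = l • coords (Fintype.card K) v) :
    ZeroOrNonsquare (disc x) := by
  have h2 : (2 : K) ≠ 0 := two_ne_zero_of_odd_card hodd
  have e0 : algebraMap K L (x 0) = l * v 0 ^ (Fintype.card K + 1) := congrFun h 0
  have e1 : algebraMap K L (x 1) =
    l * (v 0 ^ Fintype.card K * v 1 + v 0 * v 1 ^ Fintype.card K) := congrFun h 1
  have e2 : algebraMap K L (x 2) = l * v 1 ^ (Fintype.card K + 1) := congrFun h 2
  set q := Fintype.card K with hq
  have hq0 : q ≠ 0 := Fintype.card_ne_zero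
  by_cases hv1 : v 1 = 0
  · left
    have h2' : x 2 = 0 := (algebraMap K L).injective (by rw [e2, hv1]; simp)
    have h1' : x 1 = 0 := (algebraMap K L).injective (by rw [e1, hv1]; simp [hq0])
    simp [disc, h1', h2']
  · by_contra hcon
    simp only [ZeroOrNonsquare, not_or, not_not] at hcon
    obtain ⟨hne, e, he⟩ := hcon
    let φ : L →ₐ[K] L := FiniteField.frobeniusAlgHom K L
    have hφ : ∀ y, φ y = y ^ q := fun y => rfl
    have hx2 : algebraMap K L (x 2) ≠ 0 := by
      rw [e2]; exact mul_ne_zero hl (pow_ne_zero _ hv1)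
    have hx2' : x 2 ≠ 0 := fun h => hx2 (by rw [h, map_zero])
    set s : L := v 0 / v 1 with hs
    have hN : s ^ q * s = algebraMap K L (x 0 / x 2) := by
      rw [map_div₀, e0, e2, hs, div_pow]; field_simp; ring
    have hT : s ^ q + s = algebraMap K L (x 1 / x 2) := by
      rw [map_div₀, e1, e2, hs, div_pow]; field_simp; ring
    -- applying Frobenius to the trace shows that `s` lies in the quadratic extension of `K`
    have hT2 : φ (s ^ q) + s ^ q = s ^ q + s := by
      have := congrArg φ hT
      rwa [map_add, φ.commutes, ← hT, hφ s] at this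
    have hd : (s ^ q - s) ^ 2 = algebraMap K L ((e / x 2) ^ 2) := by
      have : (e / x 2) ^ 2 = (x 1 / x 2) ^ 2 - 4 * (x 0 / x 2) := by
        field_simp
        rw [disc] at he
        linear_combination - he
      rw [this, map_sub, map_pow, map_mul, ← hN, ← hT, map_ofNat]
      ring
    have hfix : φ (s ^ q - s) = s ^ q - s := by
      rw [map_pow, sq_eq_sq_iff_eq_or_eq_neg] at hd
      rcases hd with hd | hd
      · rw [hd, φ.commutes]
      · rw [hd, map_neg, φ.commutes]
    have hneg : φ (s ^ q - s) = - (s ^ q - s) := by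
      rw [map_sub, hφ s]; linear_combination hT2
    have h2L : (2 : L) ≠ 0 := by
      intro h; apply h2; apply (algebraMap K L).injective; rw [map_ofNat, h, map_zero]
    have h0 : s ^ q - s = 0 := by
      have : (2 : L) * (s ^ q - s) = 0 := by linear_combination hneg - hfix
      exact (mul_eq_zero.1 this).resolve_left h2L
    rw [h0] at hd
    have : e / x 2 = 0 := by
      have : (e / x 2) ^ 2 = 0 := (algebraMap K L).injective (by rw [← hd]; simp)
      simpa using this
    apply hne
    rw [he, (div_eq_zero_iff.1 this).resolve_right hx2', mul_zero]

/-- If `D` is zero or a nonsquare, then Frobenius changes the sign of `δ = √D`, and the point is the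
image of `s = (x₁ + δ) / (2 x₂)`. -/
theorem exists_morphism_of_zeroOrNonsquare_disc {L : Type*} [Field L] [Algebra K L] [IsAlgClosed L]
    (hodd : Odd (Fintype.card K)) {x : Fin 3 → K} (hx : x ≠ 0) (h : ZeroOrNonsquare (disc x)) :
    ∃ (v : Fin 2 → L) (l : L), v ≠ 0 ∧ l ≠ 0 ∧
      extendVec K L x = l • coords (Fintype.card K) v := by
  have h2 : (2 : K) ≠ 0 := two_ne_zero_of_odd_card hodd
  have hq0 : Fintype.card K ≠ 0 := Fintype.card_ne_zero
  by_cases hx2 : x 2 = 0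
  · have hx1 : x 1 = 0 := by
      rw [disc, hx2, mul_zero, sub_zero] at h
      exact zeroOrNonsquare_sq.1 h
    have hx0 : x 0 ≠ 0 := by
      intro h0; apply hx; funext i; fin_cases i <;> simpa
    refine ⟨![1, 0], algebraMap K L (x 0), ?_, by simpa using hx0, ?_⟩
    · intro h; simpa using congrFun h 0
    · funext i
      fin_cases i <;> simp [extendVec, coords, hx1, hx2, hq0]
  · obtain ⟨δ, hδ⟩ := IsAlgClosed.exists_pow_nat_eq (algebraMap K L (disc x)) (n := 2) two_pos
    let φ : L →ₐ[K] L := FiniteField.frobeniusAlgHom K L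
    have hφ : ∀ y, φ y = y ^ Fintype.card K := fun y => rfl
    have hδq : φ δ = - δ := by
      rcases h with h | h
      · have : δ = 0 := by
          rw [h, map_zero] at hδ; simpa using hδ
        simp [this]
      · have hne : disc x ≠ 0 := by rintro h0; rw [h0] at h; exact h (IsSquare.zero)
        have hchar := ringChar_ne_two_of_odd_card hodd
        have hh : disc x ^ (Fintype.card K / 2) = -1 :=
          (FiniteField.pow_dichotomy hchar hne).resolve_left
            (fun h1 => h ((FiniteField.isSquare_iff hchar hne).2 h1))
        have hc : Fintype.card K = 2 * (Fintype.card K / 2) + 1 := by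
          rw [Nat.odd_iff] at hodd; omega
        rw [hφ, hc, pow_add, pow_mul, hδ, ← map_pow, hh]
        simp
    have h2L : (2 : L) ≠ 0 := by
      intro h; apply h2; apply (algebraMap K L).injective; rw [map_ofNat, h, map_zero]
    have hx2L : algebraMap K L (x 2) ≠ 0 := by simpa using hx2
    have hs : ((algebraMap K L (x 1) + δ) / (2 * algebraMap K L (x 2))) ^ Fintype.card K =
        (algebraMap K L (x 1) - δ) / (2 * algebraMap K L (x 2)) := by
      rw [← hφ, map_div₀, map_add, hδq, map_mul, φ.commutes, φ.commutes, map_ofNat, sub_eq_add_neg]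
    refine ⟨![(algebraMap K L (x 1) + δ) / (2 * algebraMap K L (x 2)), 1], algebraMap K L (x 2),
      ?_, hx2L, ?_⟩
    · intro h; simpa using congrFun h 1
    · have hδ' : δ ^ 2 =
          algebraMap K L (x 1) ^ 2 - 4 * algebraMap K L (x 0) * algebraMap K L (x 2) := by
        rw [hδ, disc, map_sub, map_pow, map_mul, map_mul, map_ofNat]
      funext i
      fin_cases i
      · simp only [extendVec, coords]
        simp [pow_succ, hs]
        field_simp
        linear_combination hδ'
      · simp only [extendVec, coords]
        simp [hs]
        field_simp
        ring
      · simp [extendVec, coords]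

/-- A point of the plane lies on the curve if and only if its discriminant is zero or a
nonsquare. -/
theorem mk_mem_rationalPoints_iff (hodd : Odd (Fintype.card K)) {x : Fin 3 → K} (hx : x ≠ 0) :
    Projectivization.mk K x hx ∈ rationalPoints K ↔ ZeroOrNonsquare (disc x) := by
  have hmk : extendPoint K (AlgebraicClosure K) (Projectivization.mk K x hx) =
      Projectivization.mk _ (extendVec K (AlgebraicClosure K) x)
        (by simpa using (extendVec_injective K (AlgebraicClosure K)).ne hx) := rfl
  rw [rationalPoints, Set.mem_preimage, hmk, curve, Set.mem_range]
  constructor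
  · rintro ⟨P, hP⟩
    induction P using Projectivization.ind with
    | h v hv =>
      have hP' : Projectivization.mk _ (coords (Fintype.card K) v) (coords_ne_zero _ hv) =
        Projectivization.mk _ (extendVec K (AlgebraicClosure K) x) _ := hP
      rw [eq_comm, Projectivization.mk_eq_mk_iff] at hP'
      obtain ⟨l, hl⟩ := hP'
      exact zeroOrNonsquare_disc_of_morphism hodd l.ne_zero hl.symm
  · intro h
    obtain ⟨v, l, hv, hl, he⟩ :=
      exists_morphism_of_zeroOrNonsquare_disc (L := AlgebraicClosure K) hodd hx h
    refine ⟨Projectivization.mk _ v hv, ?_⟩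
    change Projectivization.mk _ (coords (Fintype.card K) v) (coords_ne_zero _ hv) = _
    rw [eq_comm, Projectivization.mk_eq_mk_iff]
    exact ⟨Units.mk0 l hl, he.symm⟩

end RationalPoints

/-! ### Counting the rational points on lines -/

section Counting

variable {K : Type*} [Field K] [Fintype K] [DecidableEq K]

noncomputable instance : DecidablePred (ZeroOrNonsquare (K := K)) := Classical.decPred _

/-- Twice the indicator function of `ZeroOrNonsquare`, in terms of the quadratic character. -/
theorem two_mul_ite_zeroOrNonsquare (a : K) :
    2 * (if ZeroOrNonsquare a then 1 else 0 : ℤ) =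
      1 - quadraticChar K a + (if a = 0 then 1 else 0) := by
  by_cases ha : a = 0
  · simp [ha, ZeroOrNonsquare]
  · by_cases hs : IsSquare a
    · simp [ZeroOrNonsquare, ha, hs, (quadraticChar_one_iff_isSquare ha).2 hs]
    · simp [ZeroOrNonsquare, ha, hs, quadraticChar_neg_one_iff_not_isSquare.2 hs]

theorem two_mul_card_zeroOrNonsquare (hodd : Odd (Fintype.card K)) :
    2 * (Finset.univ.filter fun a : K => ZeroOrNonsquare a).card = Fintype.card K + 1 := by
  have hchar := ringChar_ne_two_of_odd_card hodd
  zify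
  rw [Finset.card_filter]
  push_cast
  rw [Finset.mul_sum, Finset.sum_congr rfl fun a _ => two_mul_ite_zeroOrNonsquare a,
    Finset.sum_add_distrib, Finset.sum_sub_distrib, quadraticChar_sum_zero hchar]
  simp

theorem card_sq_eq (hodd : Odd (Fintype.card K)) (a : K) :
    ((Finset.univ.filter fun u : K => u ^ 2 = a).card : ℤ) = quadraticChar K a + 1 := by
  rw [← quadraticChar_card_sqrts (ringChar_ne_two_of_odd_card hodd) a]
  congr 2
  ext; simp

/-- The hyperbola `u² - w² = e` has `q - 1` points. -/
theorem card_hyperbola (hodd : Odd (Fintype.card K)) {e : K} (he : e ≠ 0) :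
    (Finset.univ.filter fun p : K × K => p.2 ^ 2 = p.1 ^ 2 - e).card = Fintype.card K - 1 := by
  have h2 := two_ne_zero_of_odd_card hodd
  have hp0 : ∀ p : K × K, p.2 ^ 2 = p.1 ^ 2 - e → p.1 + p.2 ≠ 0 := fun p hp h0 =>
    he (by linear_combination (p.1 - p.2) * h0 + hp)
  rw [← Fintype.card_units, ← Finset.card_univ]
  -- the points are parametrized by `m = u + w`, as `u - w = e / m`
  refine (Finset.card_bij (s := (Finset.univ : Finset Kˣ))
    (fun m _ => (((m : K) + e / m) / 2, ((m : K) - e / m) / 2))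
    ?_ ?_ ?_).symm
  · intro m _
    simp only [Finset.mem_filter, Finset.mem_univ, true_and]
    field_simp
    ring
  · intro m _ n _ h
    rw [Prod.mk.injEq] at h
    ext
    have h3 : (m : K) = ((m : K) + e / m) / 2 + ((m : K) - e / m) / 2 := by field_simp; ring
    have h4 : (n : K) = ((n : K) + e / n) / 2 + ((n : K) - e / n) / 2 := by field_simp; ring
    rw [h3, h4, h.1, h.2]
  · intro p hp
    simp only [Finset.mem_filter, Finset.mem_univ, true_and] at hp
    have h0 := hp0 p hp
    refine ⟨Units.mk0 _ h0, Finset.mem_univ _, ?_⟩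
    ext
    · simp only [Units.val_mk0]
      field_simp
      linear_combination hp
    · simp only [Units.val_mk0]
      field_simp
      linear_combination -hp

theorem sum_quadraticChar_sq_sub (hodd : Odd (Fintype.card K)) {e : K} (he : e ≠ 0) :
    ∑ u : K, quadraticChar K (u ^ 2 - e) = -1 := by
  have h1 : ∑ u : K, (quadraticChar K (u ^ 2 - e) + 1) = Fintype.card K - 1 := by
    simp_rw [← card_sq_eq hodd]
    have := card_hyperbola hodd he
    rw [Finset.card_filter, ← Finset.univ_product_univ, Finset.sum_product] at this
    simp_rw [← Finset.card_filter] at this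
    have hpos : 1 ≤ Fintype.card K := Fintype.card_pos
    zify [hpos] at this
    exact this
  rw [Finset.sum_add_distrib] at h1
  simp only [Finset.sum_const, Finset.card_univ, nsmul_eq_mul, mul_one] at h1
  linarith

theorem two_mul_card_zeroOrNonsquare_sq_sub (hodd : Odd (Fintype.card K)) {e : K} (he : e ≠ 0) :
    (2 * (Finset.univ.filter fun u : K => ZeroOrNonsquare (u ^ 2 - e)).card : ℤ) =
      Fintype.card K + 2 + quadraticChar K e := by
  rw [Finset.card_filter]
  push_cast
  rw [Finset.mul_sum, Finset.sum_congr rfl fun a _ => two_mul_ite_zeroOrNonsquare _,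
    Finset.sum_add_distrib, Finset.sum_sub_distrib, sum_quadraticChar_sq_sub hodd he]
  simp_rw [sub_eq_zero]
  have h := card_sq_eq hodd e
  rw [Finset.card_filter] at h
  push_cast at h
  rw [h]
  simp only [Finset.sum_const, Finset.card_univ, nsmul_eq_mul, mul_one]
  ring

theorem quadraticChar_le_one (a : K) : quadraticChar K a ≤ 1 := by
  by_cases ha : a = 0
  · simp [ha]
  · rcases quadraticChar_dichotomy ha with h | h <;> simp [h]

theorem two_mul_card_zeroOrNonsquare_sq_sub_le (hodd : Odd (Fintype.card K)) (e : K) :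
    2 * (Finset.univ.filter fun u : K => ZeroOrNonsquare (u ^ 2 - e)).card ≤
      Fintype.card K + 3 := by
  by_cases he : e = 0
  · have h1 : (Finset.univ.filter fun u : K => ZeroOrNonsquare (u ^ 2 - e)).card = 1 :=
      Finset.card_eq_one.2 ⟨0, by ext u; simp [he, zeroOrNonsquare_sq]⟩
    omega
  · have h1 := two_mul_card_zeroOrNonsquare_sq_sub hodd he
    have h2 := quadraticChar_le_one e
    zify
    linarith

/-- Coordinate vectors, one for each rational point of the curve, whose last nonzero coordinate
is `1`. -/
noncomputable def normalizedPoints (K : Type*) [Field K] [Fintype K] [DecidableEq K] :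
    Finset (Fin 3 → K) :=
  insert ![1, 0, 0] ((Finset.univ.filter fun p : K × K => ZeroOrNonsquare (p.2 ^ 2 - 4 * p.1)).image
    fun p => ![p.1, p.2, 1])

theorem card_filter_normalizedPoints (p : (Fin 3 → K) → Prop) [DecidablePred p] :
    ((normalizedPoints K).filter p).card = (if p ![1, 0, 0] then 1 else 0) +
      (Finset.univ.filter fun y : K × K =>
        ZeroOrNonsquare (y.2 ^ 2 - 4 * y.1) ∧ p ![y.1, y.2, 1]).card := by
  have hinj : Function.Injective fun p : K × K => ![p.1, p.2, 1] := by
    intro a b h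
    ext
    · exact congrFun h 0
    · exact congrFun h 1
  have hnot : ![(1 : K), 0, 0] ∉ ((Finset.univ.filter fun p : K × K =>
      ZeroOrNonsquare (p.2 ^ 2 - 4 * p.1)).image fun p => ![p.1, p.2, 1]) := by
    simp
  rw [normalizedPoints, Finset.filter_insert, Finset.filter_image, Finset.filter_filter]
  split_ifs with h
  · rw [Finset.card_insert_of_notMem (fun h' => hnot ?_), Finset.card_image_of_injective _ hinj,
      add_comm]
    exact Finset.image_subset_image (fun x hx => by
      simp only [Finset.mem_filter] at hx ⊢; exact ⟨hx.1, hx.2.1⟩) h'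
  · rw [Finset.card_image_of_injective _ hinj, zero_add]

theorem two_mul_card_zeroOrNonsquare_sq_sub_four_mul (hodd : Odd (Fintype.card K)) (y : K) :
    2 * (Finset.univ.filter fun x : K => ZeroOrNonsquare (y ^ 2 - 4 * x)).card =
      Fintype.card K + 1 := by
  have h2 := two_ne_zero_of_odd_card hodd
  have h4 : (4 : K) ≠ 0 := by
    intro h; apply h2; have : (2 : K) * 2 = 0 := by linear_combination h
    simpa using this
  rw [← two_mul_card_zeroOrNonsquare hodd]
  congr 1
  refine Finset.card_bij' (fun x _ => y ^ 2 - 4 * x) (fun a _ => (y ^ 2 - a) / 4) ?_ ?_ ?_ ?_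
  · intro x hx; simpa using hx
  · intro a ha
    simp only [Finset.mem_filter, Finset.mem_univ, true_and] at ha ⊢
    convert ha using 1
    field_simp
    ring
  · intro x _; field_simp; ring
  · intro x _; field_simp; ring

theorem two_mul_card_normalizedPoints (hodd : Odd (Fintype.card K)) :
    2 * (normalizedPoints K).card = Fintype.card K ^ 2 + Fintype.card K + 2 := by
  have h := card_filter_normalizedPoints (K := K) (fun _ => True)
  simp only [Finset.filter_true, if_true, and_true] at h
  have h' : (Finset.univ.filter fun y : K × K => ZeroOrNonsquare (y.2 ^ 2 - 4 * y.1)).card =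
      ∑ y : K, (Finset.univ.filter fun x : K => ZeroOrNonsquare (y ^ 2 - 4 * x)).card := by
    rw [Finset.card_filter, ← Finset.univ_product_univ, Finset.sum_product_right]
    simp_rw [← Finset.card_filter]
  rw [h, h', mul_add, Finset.mul_sum,
    Finset.sum_congr rfl fun y _ => two_mul_card_zeroOrNonsquare_sq_sub_four_mul hodd y]
  simp
  ring

/-- A line contains at most `(q + 3) / 2` rational points of the curve. -/
theorem two_mul_card_line_le (hodd : Odd (Fintype.card K)) {c : Fin 3 → K} (hc : c ≠ 0) :
    2 * ((normalizedPoints K).filter fun x => c ⬝ᵥ x = 0).card ≤ Fintype.card K + 3 := by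
  have h2 := two_ne_zero_of_odd_card hodd
  rw [card_filter_normalizedPoints]
  simp only [dotProduct, Fin.sum_univ_three, Matrix.cons_val_zero, Matrix.cons_val_one,
    Matrix.cons_val, mul_one, mul_zero, add_zero]
  by_cases h0 : c 0 = 0
  · simp only [h0, zero_mul, zero_add, if_true]
    by_cases h1 : c 1 = 0
    · have hc2 : c 2 ≠ 0 := by
        intro h; apply hc; funext i; fin_cases i <;> simpa
      simp [h1, hc2]
    · have hle : (Finset.univ.filter fun y : K × K =>
          ZeroOrNonsquare (y.2 ^ 2 - 4 * y.1) ∧ c 1 * y.2 + c 2 = 0).card ≤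
          (Finset.univ.filter fun x : K => ZeroOrNonsquare ((-c 2 / c 1) ^ 2 - 4 * x)).card := by
        have key : ∀ y : K × K, c 1 * y.2 + c 2 = 0 → y.2 = -c 2 / c 1 := by
          intro y hy; field_simp; linear_combination hy
        refine Finset.card_le_card_of_injOn (fun y => y.1) ?_ ?_
        · intro y hy
          simp only [Finset.coe_filter, Finset.mem_univ, true_and, Set.mem_ofPred_eq] at hy ⊢
          rw [← key y hy.2]; exact hy.1
        · intro y hy z hz hyz
          simp only [Finset.coe_filter, Finset.mem_univ, true_and, Set.mem_ofPred_eq] at hy hz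
          ext
          · exact hyz
          · rw [key y hy.2, key z hz.2]
      have := two_mul_card_zeroOrNonsquare_sq_sub_four_mul hodd (-c 2 / c 1)
      omega
  · simp only [h0, if_false, zero_add]
    have hle : (Finset.univ.filter fun y : K × K =>
          ZeroOrNonsquare (y.2 ^ 2 - 4 * y.1) ∧ c 0 * y.1 + c 1 * y.2 + c 2 = 0).card ≤
          (Finset.univ.filter fun u : K =>
            ZeroOrNonsquare (u ^ 2 - (4 * (c 1) ^ 2 / (c 0) ^ 2 - 4 * c 2 / c 0))).card := by
      have key : ∀ y : K × K, c 0 * y.1 + c 1 * y.2 + c 2 = 0 →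
          y.1 = -(c 1 * y.2 + c 2) / c 0 := by
        intro y hy; field_simp; linear_combination hy
      -- completing the square
      refine Finset.card_le_card_of_injOn (fun y => y.2 + 2 * c 1 / c 0) ?_ ?_
      · intro y hy
        simp only [Finset.coe_filter, Finset.mem_univ, true_and, Set.mem_ofPred_eq] at hy ⊢
        rw [key y hy.2] at hy
        convert hy.1 using 1
        field_simp
        ring
      · intro y hy z hz hyz
        simp only [Finset.coe_filter, Finset.mem_univ, true_and, Set.mem_ofPred_eq] at hy hz hyz
        have h := add_right_cancel hyz
        ext
        · rw [key y hy.2, key z hz.2, h]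
        · exact h
    have := two_mul_card_zeroOrNonsquare_sq_sub_le hodd
      (4 * (c 1) ^ 2 / (c 0) ^ 2 - 4 * c 2 / c 0)
    omega

/-- The line `x₀ = a² x₂`, with `a ≠ 0`, contains `(q + 3) / 2` rational points of the curve. -/
theorem two_mul_card_secant (hodd : Odd (Fintype.card K)) {a : K} (ha : a ≠ 0) :
    2 * ((normalizedPoints K).filter fun x => ![1, 0, -a ^ 2] ⬝ᵥ x = 0).card =
      Fintype.card K + 3 := by
  have h2 := two_ne_zero_of_odd_card hodd
  rw [card_filter_normalizedPoints]
  simp only [dotProduct, Fin.sum_univ_three, Matrix.cons_val_zero, Matrix.cons_val_one,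
    Matrix.cons_val, mul_one, mul_zero, add_zero, one_ne_zero, if_false, zero_add, zero_mul,
    one_mul]
  have h : (Finset.univ.filter fun y : K × K =>
      ZeroOrNonsquare (y.2 ^ 2 - 4 * y.1) ∧ y.1 + -a ^ 2 = 0).card =
      (Finset.univ.filter fun u : K => ZeroOrNonsquare (u ^ 2 - (2 * a) ^ 2)).card := by
    refine Finset.card_bij' (fun y _ => y.2) (fun u _ => (a ^ 2, u)) ?_ ?_ ?_ ?_
    · intro y hy
      simp only [Finset.mem_filter, Finset.mem_univ, true_and] at hy ⊢
      convert hy.1 using 1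
      linear_combination 4 * hy.2
    · intro u hu
      simp only [Finset.mem_filter, Finset.mem_univ, true_and] at hu ⊢
      refine ⟨?_, by ring⟩
      convert hu using 1
      ring
    · intro y hy
      simp only [Finset.mem_filter, Finset.mem_univ, true_and] at hy
      ext
      · simp only; linear_combination -hy.2
      · rfl
    · intro u _; rfl
  have h3 := two_mul_card_zeroOrNonsquare_sq_sub hodd (pow_ne_zero 2 (mul_ne_zero h2 ha))
  rw [quadraticChar_sq_one' (mul_ne_zero h2 ha)] at h3
  rw [h]
  zify
  linarith

end Counting

/-! ### Planes in a three-dimensional space -/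

section Planes

variable {K : Type*} [Field K]

theorem finrank_ker_dotProduct {c : Fin 3 → K} (hc : c ≠ 0) :
    Module.finrank K (LinearMap.ker (dotProductBilin K K c)) = 2 := by
  have h : dotProductBilin K K c ≠ 0 := by
    intro h
    apply hc
    funext i
    simpa using LinearMap.congr_fun h (Pi.single i 1)
  have := Module.Dual.finrank_ker_add_one_of_ne_zero (f := dotProductBilin K K c) h
  simp at this
  omega

theorem exists_eq_add_of_dotProduct_eq_zero {c u v : Fin 3 → K} (hc : c ≠ 0)
    (huv : LinearIndependent K ![u, v]) (hu : c ⬝ᵥ u = 0) (hv : c ⬝ᵥ v = 0) {x : Fin 3 → K}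
    (hx : c ⬝ᵥ x = 0) : ∃ a b : K, x = a • u + b • v := by
  have hle : Submodule.span K (Set.range ![u, v]) ≤ LinearMap.ker (dotProductBilin K K c) := by
    rw [Submodule.span_le]
    rintro _ ⟨i, rfl⟩
    fin_cases i
    · simpa using hu
    · simpa using hv
  have heq := Submodule.eq_of_le_of_finrank_eq hle
    (by rw [finrank_span_eq_card huv, finrank_ker_dotProduct hc]; simp)
  have hx' : x ∈ Submodule.span K (Set.range ![u, v]) := by rw [heq]; simpa using hx
  simp only [Matrix.range_cons, Matrix.range_empty, Set.union_empty, Set.singleton_union] at hx'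
  obtain ⟨a, b, h⟩ := Submodule.mem_span_pair.1 hx'
  exact ⟨a, b, h.symm⟩

theorem exists_linearIndependent_of_dotProduct (n : Fin 3 → K) {x : Fin 3 → K} (hx : x ≠ 0) :
    ∃ v, n ⬝ᵥ v = 0 ∧ LinearIndependent K ![x, v] := by
  have h2 : 2 ≤ Module.finrank K (LinearMap.ker (dotProductBilin K K n)) := by
    by_cases hn : n = 0
    · subst hn
      have : LinearMap.ker (dotProductBilin K K (0 : Fin 3 → K)) = ⊤ := by
        ext; simp
      rw [this]; simp
    · rw [finrank_ker_dotProduct hn]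
  have : ¬ LinearMap.ker (dotProductBilin K K n) ≤ Submodule.span K {x} := by
    intro h
    have := Submodule.finrank_mono h
    rw [finrank_span_singleton hx] at this
    omega
  obtain ⟨v, hv, hv'⟩ := SetLike.not_le_iff_exists.1 this
  refine ⟨v, by simpa using hv, ?_⟩
  rw [LinearIndependent.pair_iff' hx]
  intro a ha
  exact hv' (Submodule.mem_span_singleton.2 ⟨a, ha⟩)

theorem exists_dotProduct_of_linearIndependent {x y : Fin 3 → K}
    (h : LinearIndependent K ![x, y]) (a b : K) : ∃ c : Fin 3 → K, c ⬝ᵥ x = a ∧ c ⬝ᵥ y = b := by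
  let f : (Fin 3 → K) →ₗ[K] (Fin 2 → K) := (Matrix.of ![x, y]).mulVecLin
  have hf : Function.Surjective f := by
    rw [← LinearMap.range_eq_top]
    apply Submodule.eq_top_of_finrank_eq
    have : (Matrix.of ![x, y]).rank = 2 := by
      have := LinearIndependent.rank_matrix (M := Matrix.of ![x, y]) h
      simpa using this
    rw [← Matrix.rank, this]; simp
  obtain ⟨c, hc⟩ := hf ![a, b]
  refine ⟨c, ?_, ?_⟩
  · rw [dotProduct_comm]; simpa [f, Matrix.mulVec] using congrFun hc 0
  · rw [dotProduct_comm]; simpa [f, Matrix.mulVec] using congrFun hc 1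

theorem card_dotProduct_eq_zero [Fintype K] [DecidableEq K] {c : Fin 3 → K} (hc : c ≠ 0) :
    (Finset.univ.filter fun x : Fin 3 → K => c ⬝ᵥ x = 0).card = Fintype.card K ^ 2 := by
  have h := Module.natCard_eq_pow_finrank (K := K) (V := LinearMap.ker (dotProductBilin K K c))
  rw [finrank_ker_dotProduct hc, Nat.card_eq_fintype_card (α := K)] at h
  rw [← h, ← Fintype.card_subtype, ← Nat.card_eq_fintype_card]
  exact Nat.card_congr (Equiv.subtypeEquivRight fun x => by simp)

end Planes

/-! ### Forms and their restrictions to lines -/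

section Forms

open MvPolynomial

variable {K : Type*} [Field K]

/-- The linear form with coefficient vector `c`. -/
noncomputable def linForm (c : Fin 3 → K) : MvPolynomial (Fin 3) K := ∑ i, C (c i) * X i

theorem eval_linForm (c x : Fin 3 → K) : eval x (linForm c) = c ⬝ᵥ x := by
  simp [linForm, dotProduct]

theorem isHomogeneous_linForm (c : Fin 3 → K) : (linForm c).IsHomogeneous 1 :=
  IsHomogeneous.sum _ _ _ fun i _ => isHomogeneous_C_mul_X (c i) i

theorem linForm_ne_zero {c : Fin 3 → K} (hc : c ≠ 0) : linForm c ≠ 0 := by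
  intro h
  apply hc
  funext i
  have := eval_linForm c (Pi.single i 1)
  rw [h] at this
  simpa using this.symm

theorem _root_.MvPolynomial.IsHomogeneous.exists_eq_linForm
    {F : MvPolynomial (Fin 3) K} (hF : F.IsHomogeneous 1) :
    ∃ c, F = linForm c := by
  have h : F ∈ homogeneousSubmodule (Fin 3) K 1 := hF
  rw [homogeneousSubmodule_one_eq_span_X, Submodule.mem_span_range_iff_exists_fun] at h
  obtain ⟨c, hc⟩ := h
  exact ⟨c, by rw [← hc, linForm]; simp [smul_eq_C_mul]⟩

theorem _root_.MvPolynomial.IsHomogeneous.eval_smul {σ R : Type*} [CommSemiring R]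
    {F : MvPolynomial σ R} {d : ℕ}
    (hF : F.IsHomogeneous d) (a : R) (x : σ → R) : eval (a • x) F = a ^ d * eval x F := by
  rw [eval_eq, eval_eq, Finset.mul_sum]
  refine Finset.sum_congr rfl fun m hm => ?_
  rw [hF.degree_eq_sum_deg_support hm, ← Finset.prod_pow_eq_pow_sum]
  simp only [Pi.smul_apply, smul_eq_mul, mul_pow, Finset.prod_mul_distrib]
  ring

theorem eval_aeval_eq {σ τ R : Type*} [CommSemiring R] (p : σ → MvPolynomial τ R) (x : τ → R)
    (F : MvPolynomial σ R) : eval x (aeval p F) = eval (fun j => eval x (p j)) F := by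
  induction F using MvPolynomial.induction_on with
  | C a => simp
  | add p q hp hq => rw [map_add, map_add, hp, hq, map_add]
  | mul_X p i hp => simp only [map_mul, hp, aeval_X, eval_X]

/-- A form of degree at most `q` vanishing at all rational points of a line is divisible by the
equation of the line: composed with a projection onto the line it vanishes identically, and it is
congruent to this composition modulo the equation. -/
theorem linForm_dvd_of_forall [Fintype K] {F : MvPolynomial (Fin 3) K} {d : ℕ}
    (hF : F.IsHomogeneous d) (hd : d ≤ Fintype.card K) {c : Fin 3 → K} (hc : c ≠ 0)
    (h : ∀ x, c ⬝ᵥ x = 0 → eval x F = 0) : linForm c ∣ F := by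
  obtain ⟨i, hi⟩ := Function.ne_iff.1 hc
  rw [Pi.zero_apply] at hi
  set w : Fin 3 → K := Pi.single i (c i)⁻¹ with hw
  have hcw : c ⬝ᵥ w = 1 := by simp [hw, hi]
  set p : Fin 3 → MvPolynomial (Fin 3) K := fun j => X j - C (w j) * linForm c with hp
  have hzero : aeval p F = 0 := by
    refine IsHomogeneous.eq_zero_of_forall_eval_eq_zero_of_le_card (n := d) ?_ ?_ ?_
    · have := hF.aeval p (n := 1) fun j =>
        (isHomogeneous_X K j).sub ((isHomogeneous_linForm c).C_mul (w j))
      simpa using this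
    · intro x
      have hx : eval x (aeval p F) = eval (x - (c ⬝ᵥ x) • w) F := by
        rw [eval_aeval_eq]
        congr 2
        funext j
        simp [hp, eval_linForm, mul_comm]
      rw [hx]
      apply h
      rw [dotProduct_sub, dotProduct_smul, hcw]; simp
    · rw [Cardinal.mk_fintype]; exact_mod_cast hd
  have hmk : Ideal.Quotient.mk (Ideal.span {linForm c}) (aeval p F) =
      Ideal.Quotient.mk (Ideal.span {linForm c}) F := by
    change Ideal.Quotient.mkₐ K _ _ = Ideal.Quotient.mkₐ K _ _
    rw [← AlgHom.comp_apply]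
    congr 1
    apply MvPolynomial.algHom_ext
    intro j
    simp only [AlgHom.comp_apply, aeval_X, Ideal.Quotient.mkₐ_eq_mk, hp]
    rw [Ideal.Quotient.eq, Ideal.mem_span_singleton]
    exact ⟨- C (w j), by ring⟩
  rw [hzero, map_zero, eq_comm, Ideal.Quotient.eq_zero_iff_dvd] at hmk
  exact hmk

/-- No line defined over `K` is a component of the curve `F = 0`. -/
def HasNoLine (F : MvPolynomial (Fin 3) K) : Prop := ∀ c, c ≠ 0 → ¬ linForm c ∣ F

theorem HasNoLine.ne_zero {F : MvPolynomial (Fin 3) K} (hF : HasNoLine F) : F ≠ 0 := by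
  rintro rfl
  exact hF 1 one_ne_zero (dvd_zero _)

/-- The derivative of `F` in the direction `v`. -/
noncomputable def dirDeriv (v : Fin 3 → K) (F : MvPolynomial (Fin 3) K) : MvPolynomial (Fin 3) K :=
  ∑ i, C (v i) * pderiv i F

/-- The gradient of `F` at `x`. -/
noncomputable def gradient (F : MvPolynomial (Fin 3) K) (x : Fin 3 → K) : Fin 3 → K :=
  fun i => eval x (pderiv i F)

theorem eval_dirDeriv (v x : Fin 3 → K) (F : MvPolynomial (Fin 3) K) :
    eval x (dirDeriv v F) = gradient F x ⬝ᵥ v := by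
  simp [dirDeriv, gradient, dotProduct, mul_comm]

theorem _root_.MvPolynomial.IsHomogeneous.dirDeriv
    {F : MvPolynomial (Fin 3) K} {d : ℕ} (hF : F.IsHomogeneous d)
    (v : Fin 3 → K) : (dirDeriv v F).IsHomogeneous (d - 1) :=
  IsHomogeneous.sum _ _ _ fun i _ => (hF.pderiv (i := i)).C_mul _

theorem _root_.MvPolynomial.IsHomogeneous.gradient_dotProduct_self
    {F : MvPolynomial (Fin 3) K} {d : ℕ}
    (hF : F.IsHomogeneous d) (x : Fin 3 → K) : gradient F x ⬝ᵥ x = d * eval x F := by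
  have := congrArg (eval x) hF.sum_X_mul_pderiv
  simpa [gradient, dotProduct, mul_comm] using this

/-- The polynomial `F (t u + v)` in `t`. -/
noncomputable def lineRestriction (F : MvPolynomial (Fin 3) K) (u v : Fin 3 → K) : Polynomial K :=
  aeval (fun i => Polynomial.C (u i) * Polynomial.X + Polynomial.C (v i)) F

theorem lineRestriction_eq_sum (F : MvPolynomial (Fin 3) K) (u v : Fin 3 → K) :
    lineRestriction F u v = ∑ m ∈ F.support, Polynomial.C (F.coeff m) *
      ∏ i, (Polynomial.C (u i) * Polynomial.X + Polynomial.C (v i)) ^ m i := by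
  rw [lineRestriction, aeval_def, eval₂_eq']
  rfl

theorem eval_lineRestriction (F : MvPolynomial (Fin 3) K) (u v : Fin 3 → K) (t : K) :
    (lineRestriction F u v).eval t = eval (t • u + v) F := by
  rw [lineRestriction_eq_sum, eval_eq', Polynomial.eval_finsetSum]
  simp only [Polynomial.eval_mul, Polynomial.eval_C, Polynomial.eval_prod, Polynomial.eval_pow,
    Polynomial.eval_add, Polynomial.eval_X, Pi.add_apply, Pi.smul_apply, smul_eq_mul, mul_comm t]

theorem dirDeriv_mul (u : Fin 3 → K) (F G : MvPolynomial (Fin 3) K) :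
    dirDeriv u (F * G) = F * dirDeriv u G + G * dirDeriv u F := by
  simp only [dirDeriv, Derivation.leibniz, smul_eq_mul, mul_add, Finset.sum_add_distrib,
    Finset.mul_sum]
  congr 1 <;> exact Finset.sum_congr rfl fun i _ => by ring

theorem dirDeriv_add (u : Fin 3 → K) (F G : MvPolynomial (Fin 3) K) :
    dirDeriv u (F + G) = dirDeriv u F + dirDeriv u G := by
  simp only [dirDeriv, map_add, mul_add, Finset.sum_add_distrib]

theorem dirDeriv_C (u : Fin 3 → K) (a : K) : dirDeriv u (C a) = 0 := by
  simp [dirDeriv]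

theorem dirDeriv_X (u : Fin 3 → K) (i : Fin 3) : dirDeriv u (X i) = C (u i) := by
  simp [dirDeriv, pderiv_X, Pi.single_apply]

theorem derivative_lineRestriction (F : MvPolynomial (Fin 3) K) (u v : Fin 3 → K) :
    Polynomial.derivative (lineRestriction F u v) = lineRestriction (dirDeriv u F) u v := by
  induction F using MvPolynomial.induction_on with
  | C a => simp [lineRestriction, dirDeriv]
  | add p q hp hq =>
    rw [dirDeriv_add]
    simp only [lineRestriction, map_add] at hp hq ⊢
    rw [hp, hq]
  | mul_X p i hp =>
    rw [dirDeriv_mul, dirDeriv_X]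
    simp only [lineRestriction, map_mul, map_add, aeval_X, Polynomial.derivative_mul] at hp ⊢
    rw [hp]
    simp
    ring

theorem natDegree_linear_pow_le (a b : K) (n : ℕ) :
    ((Polynomial.C a * Polynomial.X + Polynomial.C b) ^ n).natDegree ≤ n := by
  simpa using Polynomial.natDegree_pow_le_of_le n (Polynomial.natDegree_linear_le (a := a) (b := b))

theorem coeff_linear_pow (a b : K) (n : ℕ) :
    ((Polynomial.C a * Polynomial.X + Polynomial.C b) ^ n).coeff n = a ^ n := by
  simpa using Polynomial.coeff_pow_of_natDegree_le (m := n)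
    (Polynomial.natDegree_linear_le (a := a) (b := b))

theorem _root_.MvPolynomial.IsHomogeneous.natDegree_lineRestriction_le
    {F : MvPolynomial (Fin 3) K} {d : ℕ} (hF : F.IsHomogeneous d) (u v : Fin 3 → K) :
    (lineRestriction F u v).natDegree ≤ d := by
  rw [lineRestriction_eq_sum]
  refine Polynomial.natDegree_sum_le_of_forall_le _ _ fun m hm => ?_
  refine (Polynomial.natDegree_C_mul_le _ _).trans ((Polynomial.natDegree_prod_le _ _).trans ?_)
  have hd : d = ∑ i, m i := by
    rw [← hF (mem_support_iff.1 hm), Finsupp.weight_apply, Finsupp.sum_fintype] <;> simp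
  rw [hd]
  exact Finset.sum_le_sum fun i _ => natDegree_linear_pow_le _ _ _

theorem _root_.MvPolynomial.IsHomogeneous.coeff_lineRestriction
    {F : MvPolynomial (Fin 3) K} {d : ℕ} (hF : F.IsHomogeneous d) (u v : Fin 3 → K) :
    (lineRestriction F u v).coeff d = eval u F := by
  rw [lineRestriction_eq_sum, Polynomial.finsetSum_coeff, eval_eq']
  refine Finset.sum_congr rfl fun m hm => ?_
  have hd : d = m 0 + m 1 + m 2 := by
    rw [← hF (mem_support_iff.1 hm), Finsupp.weight_apply, Finsupp.sum_fintype] <;>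
      simp [Fin.sum_univ_three]
  rw [Polynomial.coeff_C_mul, Fin.prod_univ_three, Fin.prod_univ_three, hd,
    Polynomial.coeff_mul_add_eq_of_natDegree_le ?_ (natDegree_linear_pow_le _ _ _),
    Polynomial.coeff_mul_add_eq_of_natDegree_le (natDegree_linear_pow_le _ _ _)
      (natDegree_linear_pow_le _ _ _), coeff_linear_pow, coeff_linear_pow, coeff_linear_pow]
  exact Polynomial.natDegree_mul_le_of_le (natDegree_linear_pow_le _ _ _)
    (natDegree_linear_pow_le _ _ _)

/-- Euler's identity, restricted to a line. -/
theorem _root_.MvPolynomial.IsHomogeneous.lineRestriction_euler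
    {F : MvPolynomial (Fin 3) K} {d : ℕ} (hF : F.IsHomogeneous d) (u v : Fin 3 → K) :
    Polynomial.X * Polynomial.derivative (lineRestriction F u v) +
      lineRestriction (dirDeriv v F) u v = (d : Polynomial K) * lineRestriction F u v := by
  have h := congrArg (fun G => lineRestriction G u v) hF.sum_X_mul_pderiv
  rw [derivative_lineRestriction]
  simp only [lineRestriction, dirDeriv, map_sum, map_mul, aeval_X, nsmul_eq_mul, map_natCast,
    Finset.mul_sum] at h ⊢
  rw [← h, ← Finset.sum_add_distrib]
  refine Finset.sum_congr rfl fun i _ => ?_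
  simp only [MvPolynomial.algHom_C, Polynomial.algebraMap_eq]
  ring

/-- The coefficient of `t ^ (d - 1)` in `F (t u + v)` is the derivative of `F` at `u` in the
direction `v`. -/
theorem _root_.MvPolynomial.IsHomogeneous.coeff_lineRestriction_pred
    {F : MvPolynomial (Fin 3) K} {d : ℕ} (hF : F.IsHomogeneous (d + 1)) (u v : Fin 3 → K) :
    (lineRestriction F u v).coeff d = gradient F u ⬝ᵥ v := by
  have h := congrArg (fun g => Polynomial.coeff g d) (hF.lineRestriction_euler u v)
  have h' := (hF.dirDeriv v).coeff_lineRestriction u v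
  rw [Nat.add_sub_cancel] at h'
  simp only [Polynomial.coeff_add] at h
  rw [h', eval_dirDeriv] at h
  have hx : (Polynomial.X * Polynomial.derivative (lineRestriction F u v)).coeff d =
      d * (lineRestriction F u v).coeff d := by
    rcases d with _ | d
    · simp
    · rw [Polynomial.coeff_X_mul, Polynomial.coeff_derivative]
      push_cast; ring
  rw [hx, ← Polynomial.C_eq_natCast, Polynomial.coeff_C_mul] at h
  push_cast at h
  linear_combination -h

/-- If no line is a component, then the restriction to a line is nonzero. -/
theorem HasNoLine.lineRestriction_ne_zero [Fintype K] {F : MvPolynomial (Fin 3) K} {d : ℕ}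
    (hF : F.IsHomogeneous d) (hd : d ≤ Fintype.card K) (h : HasNoLine F) {u v : Fin 3 → K}
    (huv : LinearIndependent K ![u, v]) : lineRestriction F u v ≠ 0 := by
  intro h0
  have hc := crossProduct_ne_zero_iff_linearIndependent.2 huv
  refine h _ hc (linForm_dvd_of_forall hF hd hc fun x hx => ?_)
  obtain ⟨a, b, rfl⟩ := exists_eq_add_of_dotProduct_eq_zero hc huv
    (by rw [dotProduct_comm, dot_self_cross]) (by rw [dotProduct_comm, dot_cross_self]) hx
  by_cases hb : b = 0
  · have h1 := hF.coeff_lineRestriction u v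
    rw [h0, Polynomial.coeff_zero] at h1
    rw [hb, zero_smul, add_zero, hF.eval_smul, ← h1, mul_zero]
  · have h1 := eval_lineRestriction F u v (a / b)
    rw [h0, Polynomial.eval_zero] at h1
    have : a • u + b • v = b • ((a / b) • u + v) := by
      rw [smul_add, smul_smul, mul_div_cancel₀ _ hb]
    rw [this, hF.eval_smul, ← h1, mul_zero]

end Forms

/-! ### Zeros of a form on the lines through a point -/

section Zeros

open MvPolynomial

variable {K : Type*} [Field K]

/-- The vectors in `S` are coordinate vectors of distinct points of the plane. -/
def RepresentsDistinctPoints (S : Finset (Fin 3 → K)) : Prop :=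
  (∀ x ∈ S, x ≠ 0) ∧ ∀ x ∈ S, ∀ y ∈ S, x ≠ y → LinearIndependent K ![x, y]

theorem RepresentsDistinctPoints.mono {S T : Finset (Fin 3 → K)} (hT : RepresentsDistinctPoints T)
    (h : S ⊆ T) : RepresentsDistinctPoints S :=
  ⟨fun x hx => hT.1 x (h hx), fun x hx y hy => hT.2 x (h hx) y (h hy)⟩

theorem linearIndependent_of_apply_eq_zero {P w : Fin 3 → K} {i : Fin 3} (hP : P i ≠ 0)
    (hw : w i = 0) (hw0 : w ≠ 0) : LinearIndependent K ![P, w] := by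
  rw [LinearIndependent.pair_iff]
  intro a b hab
  have h1 : a = 0 := by
    have := congrFun hab i
    simpa [hw, hP] using this
  subst h1
  refine ⟨rfl, ?_⟩
  simpa [hw0] using hab

theorem natDegree_lineRestriction_le_of_eval_eq_zero {F : MvPolynomial (Fin 3) K} {d : ℕ}
    (hF : F.IsHomogeneous (d + 1)) {P : Fin 3 → K} (hP : eval P F = 0) (w : Fin 3 → K) :
    (lineRestriction F P w).natDegree ≤ d := by
  rw [Polynomial.natDegree_le_iff_coeff_eq_zero]
  intro N hN
  rcases (Nat.succ_le_of_lt hN).eq_or_lt with h | h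
  · rw [← h, Nat.succ_eq_add_one, hF.coeff_lineRestriction, hP]
  · exact Polynomial.coeff_eq_zero_of_natDegree_lt
      ((hF.natDegree_lineRestriction_le _ _).trans_lt h)

theorem natDegree_lineRestriction_le_of_gradient_eq_zero {F : MvPolynomial (Fin 3) K} {d : ℕ}
    (hF : F.IsHomogeneous (d + 2)) {P : Fin 3 → K} (hP : eval P F = 0) (hP' : gradient F P = 0)
    (w : Fin 3 → K) : (lineRestriction F P w).natDegree ≤ d := by
  rw [Polynomial.natDegree_le_iff_coeff_eq_zero]
  intro N hN
  rcases (Nat.succ_le_of_lt hN).eq_or_lt with h | h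
  · rw [← h, Nat.succ_eq_add_one, hF.coeff_lineRestriction_pred, hP', zero_dotProduct]
  · exact Polynomial.coeff_eq_zero_of_natDegree_lt
      ((natDegree_lineRestriction_le_of_eval_eq_zero hF hP w).trans_lt h)

variable [Fintype K] [DecidableEq K]

/-- The nonzero vectors at which `F` vanishes. -/
noncomputable def zeroVectors (F : MvPolynomial (Fin 3) K) : Finset (Fin 3 → K) :=
  Finset.univ.filter fun x => x ≠ 0 ∧ eval x F = 0

theorem mem_zeroVectors {F : MvPolynomial (Fin 3) K} {x : Fin 3 → K} :
    x ∈ zeroVectors F ↔ x ≠ 0 ∧ eval x F = 0 := by simp [zeroVectors]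

theorem RepresentsDistinctPoints.card_mul_le {S : Finset (Fin 3 → K)}
    (hS : RepresentsDistinctPoints S) {F : MvPolynomial (Fin 3) K} {d : ℕ}
    (hF : F.IsHomogeneous d) (h : ∀ x ∈ S, eval x F = 0) :
    S.card * (Fintype.card K - 1) ≤ (zeroVectors F).card := by
  rw [← Fintype.card_units, ← Finset.card_univ, ← Finset.card_product]
  refine Finset.card_le_card_of_injOn (fun p => (p.2 : K) • p.1) ?_ ?_
  · intro p hp
    have hp1 := (Finset.mem_product.1 hp).1
    refine mem_zeroVectors.2 ⟨smul_ne_zero p.2.ne_zero (hS.1 _ hp1), ?_⟩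
    rw [hF.eval_smul, h _ hp1, mul_zero]
  · intro p hp r hr hpr
    have hp1 := (Finset.mem_product.1 hp).1
    have hr1 := (Finset.mem_product.1 hr).1
    have h1 : p.1 = r.1 := by
      by_contra hne
      have := (LinearIndependent.pair_iff.1 (hS.2 _ hp1 _ hr1 hne)) (p.2 : K) (-(r.2 : K))
        (by rw [neg_smul, ← sub_eq_add_neg, sub_eq_zero]; exact hpr)
      exact p.2.ne_zero this.1
    have h2 : (p.2 : K) = r.2 := by
      have hpr' : (p.2 : K) • p.1 = (r.2 : K) • r.1 := hpr
      rw [h1] at hpr'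
      exact smul_left_injective K (hS.1 _ hr1) hpr'
    exact Prod.ext h1 (Units.ext h2)

/-- Counting zeros along the lines through a point `P`: every line through `P` contains at most `k`
zeros besides `P`, if `F (t P + w)` has degree at most `k`. -/
theorem card_zeroVectors_le {F : MvPolynomial (Fin 3) K} {d : ℕ} (hF : F.IsHomogeneous d)
    (hd : d ≤ Fintype.card K) (hline : HasNoLine F) {P : Fin 3 → K} (hP : P ≠ 0) {k : ℕ}
    (hk : ∀ w, (lineRestriction F P w).natDegree ≤ k) :
    (zeroVectors F).card ≤ (Fintype.card K - 1) + (Fintype.card K ^ 2 - 1) * k := by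
  -- every vector is `t • P + w` for unique `t` and `w` in the complement `wᵢ = 0` of `P`
  obtain ⟨i, hi⟩ := Function.ne_iff.1 hP
  rw [Pi.zero_apply] at hi
  set W : Finset (Fin 3 → K) := Finset.univ.filter fun x => Pi.single i 1 ⬝ᵥ x = 0 with hW
  have hWcard : W.card = Fintype.card K ^ 2 := by
    convert card_dotProduct_eq_zero (c := Pi.single i (1 : K)) ?_
    simp
  have hWmem : ∀ w, w ∈ W ↔ w i = 0 := by intro w; simp [hW]
  set f : (Fin 3 → K) → (Fin 3 → K) := fun x => x - (x i / P i) • P with hf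
  have hfW : ∀ x ∈ zeroVectors F, f x ∈ W := by
    intro x _
    rw [hWmem]
    simp [hf, hi]
  have hfx : ∀ x, x = (x i / P i) • P + f x := by intro x; simp [hf]
  rw [Finset.card_eq_sum_card_fiberwise hfW,
    ← Finset.add_sum_erase W _ ((hWmem 0).2 rfl)]
  refine add_le_add ?_ ?_
  · rw [← Fintype.card_units, ← Finset.card_univ]
    refine (Finset.card_le_card (t := Finset.univ.image fun u : Kˣ => (u : K) • P) ?_).trans
      Finset.card_image_le
    intro x hx
    rw [Finset.mem_filter, mem_zeroVectors] at hx
    have hx' := hfx x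
    rw [hx.2, add_zero] at hx'
    have h0 : x i / P i ≠ 0 := by
      intro h; rw [h, zero_smul] at hx'; exact hx.1.1 hx'
    exact Finset.mem_image.2 ⟨Units.mk0 _ h0, Finset.mem_univ _, hx'.symm⟩
  · rw [← hWcard, ← Finset.card_erase_of_mem ((hWmem 0).2 rfl), ← smul_eq_mul]
    refine Finset.sum_le_card_nsmul _ _ _ fun w hw => ?_
    rw [Finset.mem_erase, hWmem] at hw
    have hne := hline.lineRestriction_ne_zero hF hd
      (linearIndependent_of_apply_eq_zero hi hw.2 hw.1)
    refine le_trans ?_ ((Multiset.toFinset_card_le _).trans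
      ((Polynomial.card_roots' (lineRestriction F P w)).trans (hk w)))
    refine Finset.card_le_card_of_injOn (fun x => x i / P i) ?_ ?_
    · intro x hx
      rw [Finset.mem_coe, Finset.mem_filter, mem_zeroVectors] at hx
      rw [Finset.mem_coe, Multiset.mem_toFinset, Polynomial.mem_roots hne, Polynomial.IsRoot.def,
        eval_lineRestriction]
      have hx' := hfx x
      rw [hx.2] at hx'
      rw [← hx']
      exact hx.1.2
    · intro x hx y hy hxy
      rw [Finset.mem_coe, Finset.mem_filter] at hx hy
      rw [hfx x, hfx y, hx.2, hy.2]
      exact congrArg (fun t => t • P + w) hxy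

/-- Every point of the plane has `q - 1` coordinate vectors. -/
theorem card_le_of_card_zeroVectors_le {S : Finset (Fin 3 → K)}
    (hS : RepresentsDistinctPoints S) {F : MvPolynomial (Fin 3) K} {d : ℕ}
    (hF : F.IsHomogeneous d) (h : ∀ x ∈ S, eval x F = 0) {k : ℕ}
    (hk : (zeroVectors F).card ≤ (Fintype.card K - 1) + (Fintype.card K ^ 2 - 1) * k) :
    S.card ≤ 1 + (Fintype.card K + 1) * k := by
  have h1 := (hS.card_mul_le hF h).trans hk
  have hq : 1 < Fintype.card K := Fintype.one_lt_card
  obtain ⟨r, hr⟩ := Nat.exists_eq_add_of_lt hq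
  have e1 : Fintype.card K - 1 = r + 1 := by omega
  have e2 : Fintype.card K ^ 2 - 1 = (r + 1) * (Fintype.card K + 1) := by
    rw [hr]; refine Nat.sub_eq_of_eq_add ?_; ring
  rw [e1, e2] at h1
  refine Nat.le_of_mul_le_mul_left (c := r + 1) ?_ (by omega)
  linarith

/-- A conic without line components has at most `q + 2` rational points. -/
theorem card_le_of_conic {S : Finset (Fin 3 → K)} (hS : RepresentsDistinctPoints S)
    {F : MvPolynomial (Fin 3) K} (hF : F.IsHomogeneous 2) (hline : HasNoLine F)
    (h : ∀ x ∈ S, eval x F = 0) : S.card ≤ Fintype.card K + 2 := by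
  rcases S.eq_empty_or_nonempty with rfl | ⟨P, hP⟩
  · simp
  · have := card_le_of_card_zeroVectors_le hS hF h (card_zeroVectors_le hF Fintype.one_lt_card hline
      (hS.1 P hP) (natDegree_lineRestriction_le_of_eval_eq_zero hF (h P hP)))
    omega

/-- A cubic without line components that has a singular rational point has at most `q + 2`
rational points. -/
theorem card_le_of_singular_cubic {S : Finset (Fin 3 → K)} (hS : RepresentsDistinctPoints S)
    {F : MvPolynomial (Fin 3) K} (hF : F.IsHomogeneous 3) (hq : 3 ≤ Fintype.card K)
    (hline : HasNoLine F) (h : ∀ x ∈ S, eval x F = 0) {P : Fin 3 → K} (hP : P ≠ 0)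
    (hFP : eval P F = 0) (hgrad : gradient F P = 0) : S.card ≤ Fintype.card K + 2 := by
  have := card_le_of_card_zeroVectors_le hS hF h (card_zeroVectors_le hF hq hline hP
    (natDegree_lineRestriction_le_of_gradient_eq_zero hF hFP hgrad))
  omega

end Zeros

/-! ### Common tangents of coprime curves -/

section Bezout

open MvPolynomial

variable {K : Type*} [Field K]

theorem finrank_homogeneousSubmodule (n : ℕ) :
    Module.finrank K (homogeneousSubmodule (Fin 3) K n) = (n + 2).choose 2 := by
  have h1 : homogeneousSubmodule (Fin 3) K n = restrictSupport K {d : Fin 3 →₀ ℕ | d.degree = n} :=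
    homogeneousSubmodule_eq_finsupp_supported _ _ _
  have h2 : {d : Fin 3 →₀ ℕ | d.degree = n} =
      ((Finset.univ : Finset (Fin 3)).finsuppAntidiag n : Set (Fin 3 →₀ ℕ)) := by
    ext d
    simp [Finsupp.degree_eq_sum]
  rw [h1, h2, Module.finrank_eq_nat_card_basis (basisRestrictSupport K _), Nat.card_coe_set_eq,
    Set.ncard_coe_finset, Finset.card_finsuppAntidiag_nat_eq_choose, Finset.card_univ,
    Fintype.card_fin, show 3 + n - 1 = n + 2 by omega, Nat.choose_symm_add]

theorem finite_homogeneousSubmodule (n : ℕ) :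
    Module.Finite K (homogeneousSubmodule (Fin 3) K n) :=
  Module.Finite.iff_fg.2 (homogeneousSubmodule_fg _ _ n)

theorem two_mul_finrank_homogeneousSubmodule (n : ℕ) :
    2 * Module.finrank K (homogeneousSubmodule (Fin 3) K n) = (n + 1) * (n + 2) := by
  rw [finrank_homogeneousSubmodule]
  induction n with
  | zero => rfl
  | succ n ih =>
    rw [show n + 1 + 2 = (n + 2) + 1 by ring, Nat.choose_succ_succ' (n + 2) 1, Nat.choose_one_right]
    linarith

theorem isHomogeneous_of_mul {F C : MvPolynomial (Fin 3) K} {a j : ℕ} (hF : F.IsHomogeneous a)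
    (hF0 : F ≠ 0) (h : (F * C).IsHomogeneous (a + j)) : C.IsHomogeneous j := by
  let := gradedAlgebra (σ := Fin 3) (R := K)
  have h1 := DirectSum.coe_decompose_mul_add_of_left_mem (homogeneousSubmodule (Fin 3) K)
    (i := a) (j := j) (a := F) (b := C) hF
  rw [DirectSum.decompose_of_mem_same _ h] at h1
  rw [mul_left_cancel₀ hF0 h1]
  exact (DirectSum.decompose (homogeneousSubmodule (Fin 3) K) C j).2

/-- The homogeneous component of top degree of a product is the product of those of the factors,
so that a factorization of a form can be replaced by one into forms. -/
theorem exists_isHomogeneous_factors {F A B : MvPolynomial (Fin 3) K} {d : ℕ}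
    (hF : F.IsHomogeneous d) (hF0 : F ≠ 0) (h : F = A * B) :
    ∃ A' B' : MvPolynomial (Fin 3) K, F = A' * B' ∧ A'.IsHomogeneous A.totalDegree ∧
      B'.IsHomogeneous B.totalDegree := by
  refine ⟨homogeneousComponent A.totalDegree A, homogeneousComponent B.totalDegree B, ?_,
    homogeneousComponent_isHomogeneous _ _, homogeneousComponent_isHomogeneous _ _⟩
  have hA0 : A ≠ 0 := by rintro rfl; exact hF0 (by rw [h, zero_mul])
  have hB0 : B ≠ 0 := by rintro rfl; exact hF0 (by rw [h, mul_zero])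
  have hdeg : A.totalDegree + B.totalDegree = d := by
    rw [← totalDegree_mul_of_isDomain hA0 hB0, ← h, hF.totalDegree hF0]
  have hmem : ∀ i j, homogeneousComponent i A * homogeneousComponent j B ∈
      homogeneousSubmodule (Fin 3) K (i + j) := fun i j =>
    (homogeneousComponent_isHomogeneous _ _).mul (homogeneousComponent_isHomogeneous _ _)
  have hsum : F = ∑ i ∈ Finset.range (A.totalDegree + 1), ∑ j ∈ Finset.range (B.totalDegree + 1),
      homogeneousComponent d (homogeneousComponent i A * homogeneousComponent j B) := by
    conv_lhs => rw [← homogeneousComponent_eq_self hF, h]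
    rw [← sum_homogeneousComponent A, ← sum_homogeneousComponent B, Finset.sum_mul_sum]
    simp only [map_sum, sum_homogeneousComponent]
  rw [hsum, Finset.sum_eq_single A.totalDegree, Finset.sum_eq_single B.totalDegree,
    homogeneousComponent_of_mem (hmem _ _), if_pos hdeg.symm]
  · intro j hj hne
    rw [homogeneousComponent_of_mem (hmem _ _), if_neg]
    omega
  · intro hn; exact absurd (Finset.self_mem_range_succ _) hn
  · intro i hi hne
    refine Finset.sum_eq_zero fun j hj => ?_
    rw [homogeneousComponent_of_mem (hmem _ _), if_neg]
    rw [Finset.mem_range] at hi hj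
    omega
  · intro hn; exact absurd (Finset.self_mem_range_succ _) hn

theorem hasNoLine_or_exists_eq_mul {F : MvPolynomial (Fin 3) K} {d : ℕ}
    (hF : F.IsHomogeneous (d + 1)) (hF0 : F ≠ 0) : HasNoLine F ∨
      ∃ L G : MvPolynomial (Fin 3) K, L.IsHomogeneous 1 ∧ L ≠ 0 ∧ G.IsHomogeneous d ∧ G ≠ 0 ∧
        F = L * G := by
  by_cases h : HasNoLine F
  · exact Or.inl h
  · right
    simp only [HasNoLine, not_forall, not_not] at h
    obtain ⟨c, hc, G, rfl⟩ := h
    exact ⟨linForm c, G, isHomogeneous_linForm c, linForm_ne_zero hc,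
      isHomogeneous_of_mul (isHomogeneous_linForm c) (linForm_ne_zero hc) (by rwa [add_comm]),
      right_ne_zero_of_mul hF0, rfl⟩

/-- In a nontrivial factorization of a cubic form, one of the factors is linear. -/
theorem HasNoLine.irreducible_of_cubic {F : MvPolynomial (Fin 3) K} (hF : F.IsHomogeneous 3)
    (hline : HasNoLine F) : Irreducible F := by
  have hF0 := hline.ne_zero
  constructor
  · intro hu
    have := (MvPolynomial.isUnit_iff_totalDegree_of_isReduced.1 hu).2
    rw [hF.totalDegree hF0] at this
    omega
  · intro A B hAB
    have hA0 : A ≠ 0 := by rintro rfl; simp at hAB; exact hF0 hAB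
    have hB0 : B ≠ 0 := by rintro rfl; simp at hAB; exact hF0 hAB
    have hdeg : A.totalDegree + B.totalDegree = 3 := by
      rw [← totalDegree_mul_of_isDomain hA0 hB0, ← hAB, hF.totalDegree hF0]
    obtain ⟨A', B', hAB', hA', hB'⟩ := exists_isHomogeneous_factors hF hF0 hAB
    have hunit : ∀ G : MvPolynomial (Fin 3) K, G ≠ 0 → G.totalDegree = 0 → IsUnit G := by
      intro G hG0 hG
      rw [totalDegree_eq_zero_iff_eq_C] at hG
      rw [hG] at hG0 ⊢
      exact (isUnit_iff_ne_zero.2 (fun h => hG0 (by rw [h, C_0]))).map C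
    have hlin : ∀ G : MvPolynomial (Fin 3) K, G ∣ F → ¬ G.IsHomogeneous 1 := by
      intro G hG hG1
      obtain ⟨c, rfl⟩ := hG1.exists_eq_linForm
      refine hline c ?_ hG
      rintro rfl
      simp [linForm] at hG
      exact hF0 hG
    have h1 : A.totalDegree ≠ 1 := fun h => hlin A' ⟨B', hAB'⟩ (h ▸ hA')
    have h2 : B.totalDegree ≠ 1 := fun h => hlin B' ⟨A', by rw [hAB', mul_comm]⟩ (h ▸ hB')
    by_cases hA : A.totalDegree = 0
    · exact Or.inl (hunit A hA0 hA)
    · exact Or.inr (hunit B hB0 (by omega))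

/-- The value of a polynomial at `x` and its derivative at `x` in the direction `v`. -/
noncomputable def jet (x v : Fin 3 → K) : MvPolynomial (Fin 3) K →ₗ[K] K × K where
  toFun F := (eval x F, eval x (dirDeriv v F))
  map_add' F G := by simp [dirDeriv_add]
  map_smul' c F := by simp [smul_eq_C_mul, dirDeriv_mul, dirDeriv_C]

theorem jet_mul_eq_zero {x v : Fin 3 → K} {F : MvPolynomial (Fin 3) K} (h : jet x v F = 0)
    (G : MvPolynomial (Fin 3) K) : jet x v (F * G) = 0 := by
  have h1 : eval x F = 0 := congrArg Prod.fst h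
  have h2 : eval x (dirDeriv v F) = 0 := congrArg Prod.snd h
  simp [jet, dirDeriv_mul, h1, h2]

theorem jet_sq_eq_zero {x v : Fin 3 → K} {F : MvPolynomial (Fin 3) K} (h : eval x F = 0) :
    jet x v (F ^ 2) = 0 := by
  simp [jet, sq, dirDeriv_mul, h]

theorem dirDeriv_linForm (v c : Fin 3 → K) : dirDeriv v (linForm c) = C (c ⬝ᵥ v) := by
  simp [dirDeriv, linForm, pderiv_X, Pi.single_apply, dotProduct, mul_comm]

/-- Forms of large degree have arbitrary `1`-jets, in given directions, at distinct points. -/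
theorem exists_isHomogeneous_jet_eq [DecidableEq K] {S : Finset (Fin 3 → K)}
    (hS : RepresentsDistinctPoints S)
    {v : (Fin 3 → K) → (Fin 3 → K)} (hv : ∀ x ∈ S, LinearIndependent K ![x, v x]) {m : ℕ}
    (hm : 2 * S.card ≤ m) {x : Fin 3 → K} (hx : x ∈ S) (a b : K) :
    ∃ G : MvPolynomial (Fin 3) K, G.IsHomogeneous m ∧ jet x (v x) G = (a, b) ∧
      ∀ y ∈ S, y ≠ x → jet y (v y) G = 0 := by
  have hc : ∀ y, ∃ c : Fin 3 → K, c ⬝ᵥ x = 1 ∧ (y ∈ S → y ≠ x → c ⬝ᵥ y = 0) := by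
    intro y
    by_cases h : y ∈ S ∧ y ≠ x
    · obtain ⟨c, h1, h2⟩ := exists_dotProduct_of_linearIndependent
        (hS.2 x hx y h.1 h.2.symm) 1 0
      exact ⟨c, h1, fun _ _ => h2⟩
    · obtain ⟨c, h1, -⟩ := exists_dotProduct_of_linearIndependent (hv x hx) 1 0
      exact ⟨c, h1, fun h1 h2 => absurd ⟨h1, h2⟩ h⟩
  choose c hcx hcy using hc
  -- `U` vanishes doubly at the other points, and the last factor only adjusts the degree
  set U : MvPolynomial (Fin 3) K :=
    (∏ y ∈ S.erase x, linForm (c y) ^ 2) * linForm (c x) ^ (m - 1 - 2 * (S.card - 1)) with hU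
  have hUhom : U.IsHomogeneous (m - 1) := by
    have h1 : (∏ y ∈ S.erase x, linForm (c y) ^ 2).IsHomogeneous (∑ y ∈ S.erase x, 1 * 2) :=
      IsHomogeneous.prod _ _ _ fun y _ => (isHomogeneous_linForm (c y)).pow 2
    have h2 := h1.mul ((isHomogeneous_linForm (c x)).pow (m - 1 - 2 * (S.card - 1)))
    convert h2 using 1
    have : 1 ≤ S.card := Finset.card_pos.2 ⟨x, hx⟩
    simp [Finset.card_erase_of_mem hx]
    omega
  have hUx : eval x U = 1 := by
    simp [hU, eval_linForm, hcx]
  have hUy : ∀ y ∈ S, y ≠ x → jet y (v y) U = 0 := by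
    intro y hy hyx
    rw [hU, ← Finset.mul_prod_erase _ _ (Finset.mem_erase.2 ⟨hyx, hy⟩), mul_assoc]
    exact jet_mul_eq_zero (jet_sq_eq_zero (by rw [eval_linForm, hcy y hy hyx])) _
  obtain ⟨l, hl1, hl2⟩ := exists_dotProduct_of_linearIndependent (hv x hx) a
    (b - a * eval x (dirDeriv (v x) U))
  refine ⟨U * linForm l, ?_, ?_, fun y hy hyx => jet_mul_eq_zero (hUy y hy hyx) _⟩
  · have : 1 ≤ S.card := Finset.card_pos.2 ⟨x, hx⟩
    convert hUhom.mul (isHomogeneous_linForm l) using 1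
    omega
  · simp [jet, dirDeriv_mul, hUx, eval_linForm, hl1, dirDeriv_linForm, hl2]

/-- The forms of degree `k + a + b` in the ideal generated by two coprime forms of degrees `a` and
`b` have codimension at most `a * b`. -/
theorem finrank_le_of_coprime {F G : MvPolynomial (Fin 3) K} {a b : ℕ} (hF : F.IsHomogeneous a)
    (hG : G.IsHomogeneous b) (hFp : Prime F) (hFG : ¬ F ∣ G) (k : ℕ) :
    Module.finrank K (homogeneousSubmodule (Fin 3) K (k + a + b)) ≤
      Module.finrank K ((homogeneousSubmodule (Fin 3) K (k + b)).map (LinearMap.mulLeft K F) ⊔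
        (homogeneousSubmodule (Fin 3) K (k + a)).map (LinearMap.mulLeft K G) :
        Submodule K (MvPolynomial (Fin 3) K)) + a * b := by
  have hG0 : G ≠ 0 := by rintro rfl; exact hFG (dvd_zero _)
  have hfin := finite_homogeneousSubmodule (K := K)
  have hmap : ∀ (P : MvPolynomial (Fin 3) K), P ≠ 0 → ∀ n, Module.finrank K
      ((homogeneousSubmodule (Fin 3) K n).map (LinearMap.mulLeft K P)) =
      Module.finrank K (homogeneousSubmodule (Fin 3) K n) := by
    intro P hP n
    have hinj : Function.Injective (LinearMap.mulLeft K P) := mul_right_injective₀ hP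
    exact (Submodule.equivMapOfInjective _ hinj _).finrank_eq.symm
  -- multiples of both `F` and `G` are multiples of `G * F`
  have hinf : (homogeneousSubmodule (Fin 3) K (k + b)).map (LinearMap.mulLeft K F) ⊓
      (homogeneousSubmodule (Fin 3) K (k + a)).map (LinearMap.mulLeft K G) ≤
      (homogeneousSubmodule (Fin 3) K k).map (LinearMap.mulLeft K (G * F)) := by
    rintro _ ⟨⟨A, hA, rfl⟩, ⟨B, hB, hAB⟩⟩
    simp only [LinearMap.mulLeft_apply] at hAB
    obtain ⟨D, rfl⟩ := (hFp.dvd_or_dvd ⟨A, hAB⟩).resolve_left hFG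
    refine ⟨D, isHomogeneous_of_mul hF hFp.ne_zero (j := k) (by rw [add_comm]; exact hB), ?_⟩
    simp only [LinearMap.mulLeft_apply]
    rw [← hAB]; ring
  have h1 := Submodule.finrank_sup_add_finrank_inf_eq
    ((homogeneousSubmodule (Fin 3) K (k + b)).map (LinearMap.mulLeft K F))
    ((homogeneousSubmodule (Fin 3) K (k + a)).map (LinearMap.mulLeft K G))
  have h2 := Submodule.finrank_mono hinf
  rw [hmap _ hFp.ne_zero, hmap _ hG0] at h1
  rw [hmap _ (mul_ne_zero hG0 hFp.ne_zero)] at h2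
  have e1 := two_mul_finrank_homogeneousSubmodule (K := K) k
  have e2 := two_mul_finrank_homogeneousSubmodule (K := K) (k + a)
  have e3 := two_mul_finrank_homogeneousSubmodule (K := K) (k + b)
  have e4 := two_mul_finrank_homogeneousSubmodule (K := K) (k + a + b)
  have e5 : (k + a + b + 1) * (k + a + b + 2) + (k + 1) * (k + 2) =
    (k + a + 1) * (k + a + 2) + (k + b + 1) * (k + b + 2) + 2 * (a * b) := by ring
  omega

/-- A weak form of Bézout's theorem: if two coprime curves of degrees `a` and `b` have a common
tangent direction at each of `n` common points, then `2 n ≤ a b`. -/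
theorem two_mul_card_le_mul [DecidableEq K] {F G : MvPolynomial (Fin 3) K} {a b : ℕ}
    (hF : F.IsHomogeneous a)
    (hG : G.IsHomogeneous b) (hFp : Prime F) (hFG : ¬ F ∣ G) {S : Finset (Fin 3 → K)}
    (hS : RepresentsDistinctPoints S) {v : (Fin 3 → K) → (Fin 3 → K)}
    (hv : ∀ x ∈ S, LinearIndependent K ![x, v x]) (hFS : ∀ x ∈ S, jet x (v x) F = 0)
    (hGS : ∀ x ∈ S, jet x (v x) G = 0) : 2 * S.card ≤ a * b := by
  have hfin := finite_homogeneousSubmodule (K := K)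
  -- a degree in which the `2 n` values and derivatives are independent
  set m := 2 * S.card + a + b with hm
  let V := homogeneousSubmodule (Fin 3) K m
  let φ : V →ₗ[K] (S → K × K) := (LinearMap.pi fun x : S => jet x.1 (v x.1)).domRestrict V
  have hφ : ∀ (A : V) (x : S), φ A x = jet x.1 (v x.1) A.1 := fun _ _ => rfl
  have hsurj : LinearMap.range φ = ⊤ := by
    rw [eq_top_iff]
    intro y _
    rw [← Finset.univ_sum_single y]
    refine Submodule.sum_mem _ fun x _ => ?_
    obtain ⟨A, hA, hAx, hAy⟩ := exists_isHomogeneous_jet_eq hS hv (m := m) (by omega) x.2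
      (y x).1 (y x).2
    refine ⟨⟨A, hA⟩, ?_⟩
    funext z
    rw [hφ]
    by_cases hz : z = x
    · subst hz; rw [Pi.single_eq_same]; exact hAx
    · rw [Pi.single_eq_of_ne hz]
      exact hAy z.1 z.2 fun h => hz (Subtype.ext h)
  have h1 := φ.finrank_range_add_finrank_ker
  rw [hsurj, finrank_top, Module.finrank_pi_fintype] at h1
  simp only [Module.finrank_prod, Module.finrank_self, Finset.sum_const, Finset.card_univ,
    Fintype.card_coe, smul_eq_mul] at h1
  set W : Submodule K (MvPolynomial (Fin 3) K) :=
    (homogeneousSubmodule (Fin 3) K (2 * S.card + b)).map (LinearMap.mulLeft K F) ⊔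
      (homogeneousSubmodule (Fin 3) K (2 * S.card + a)).map (LinearMap.mulLeft K G) with hW
  have hWV : W ≤ (LinearMap.ker φ).map V.subtype := by
    rw [hW, sup_le_iff]
    constructor
    · rintro _ ⟨A, hA, rfl⟩
      refine ⟨⟨F * A, ?_⟩, ?_, rfl⟩
      · have := hF.mul hA
        rwa [show a + (2 * S.card + b) = m by omega] at this
      · rw [SetLike.mem_coe, LinearMap.mem_ker]
        funext x
        rw [hφ]
        exact jet_mul_eq_zero (hFS x.1 x.2) A
    · rintro _ ⟨A, hA, rfl⟩
      refine ⟨⟨G * A, ?_⟩, ?_, rfl⟩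
      · have := hG.mul hA
        rwa [show b + (2 * S.card + a) = m by omega] at this
      · rw [SetLike.mem_coe, LinearMap.mem_ker]
        funext x
        rw [hφ]
        exact jet_mul_eq_zero (hGS x.1 x.2) A
  have h2 := Submodule.finrank_mono hWV
  rw [← (Submodule.equivMapOfInjective _ V.injective_subtype _).finrank_eq] at h2
  have h3 := finrank_le_of_coprime hF hG hFp hFG (2 * S.card)
  rw [← hW, ← hm] at h3
  have hV : Module.finrank K V = Module.finrank K (homogeneousSubmodule (Fin 3) K m) := rfl
  omega

end Bezout

/-! ### Rational points of cubics -/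

section Frobenius

open MvPolynomial

variable {K : Type*} [Field K]

theorem pderiv_comm {σ R : Type*} [CommRing R] (i j : σ) (F : MvPolynomial σ R) :
    pderiv i (pderiv j F) = pderiv j (pderiv i F) := by
  classical
  have h : ⁅pderiv (R := R) i, pderiv (R := R) j⁆ = 0 := by
    apply MvPolynomial.derivation_ext
    intro k
    simp [Derivation.commutator_apply, pderiv_X, Pi.single_apply, apply_ite]
  have := congrArg (fun D : Derivation R (MvPolynomial σ R) (MvPolynomial σ R) => D F) h
  simpa [Derivation.commutator_apply, sub_eq_zero] using this

theorem dirDeriv_pderiv (v : Fin 3 → K) (i : Fin 3) (F : MvPolynomial (Fin 3) K) :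
    dirDeriv v (pderiv i F) = pderiv i (dirDeriv v F) := by
  simp [dirDeriv, pderiv_comm i]

theorem exists_smul_eq_of_dotProduct_eq_zero {c n u v : Fin 3 → K}
    (huv : LinearIndependent K ![u, v]) (hn : n ≠ 0) (hnu : n ⬝ᵥ u = 0) (hnv : n ⬝ᵥ v = 0)
    (hcu : c ⬝ᵥ u = 0) (hcv : c ⬝ᵥ v = 0) : ∃ l : K, c = l • n := by
  obtain ⟨i, hi⟩ := Function.ne_iff.1 hn
  rw [Pi.zero_apply] at hi
  refine ⟨c i / n i, funext fun j => ?_⟩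
  have h0 : n ⬝ᵥ (Pi.single j (n i) - Pi.single i (n j)) = 0 := by
    rw [dotProduct_sub, dotProduct_single, dotProduct_single]; ring
  obtain ⟨a, b, hab⟩ := exists_eq_add_of_dotProduct_eq_zero hn huv hnu hnv h0
  have h1 : c ⬝ᵥ (Pi.single j (n i) - Pi.single i (n j)) = 0 := by
    rw [hab, dotProduct_add, dotProduct_smul, dotProduct_smul, hcu, hcv]; simp
  rw [dotProduct_sub, dotProduct_single, dotProduct_single] at h1
  rw [Pi.smul_apply, smul_eq_mul]
  field_simp
  linear_combination h1

theorem _root_.MvPolynomial.IsHomogeneous.gradient_smul {F : MvPolynomial (Fin 3) K} {d : ℕ}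
    (hF : F.IsHomogeneous d) (a : K) (x : Fin 3 → K) :
    gradient F (a • x) = a ^ (d - 1) • gradient F x := by
  funext i
  exact (hF.pderiv).eval_smul a x

theorem smul_add_ne_zero {u v : Fin 3 → K} (huv : LinearIndependent K ![u, v]) (t : K) :
    t • u + v ≠ 0 := by
  intro h
  have := (LinearIndependent.pair_iff.1 huv) t 1 (by rwa [one_smul])
  exact one_ne_zero this.2

variable [Fintype K]

/-- The form `∑ᵢ Xᵢ^q ∂F/∂Xᵢ`. It vanishes at a smooth point of the curve `F = 0` exactly if the
tangent line at the point passes through the image of the point under Frobenius. -/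
noncomputable def frobeniusForm (F : MvPolynomial (Fin 3) K) : MvPolynomial (Fin 3) K :=
  ∑ i, X i ^ Fintype.card K * pderiv i F

theorem isHomogeneous_frobeniusForm {F : MvPolynomial (Fin 3) K} {d : ℕ} (hF : F.IsHomogeneous d) :
    (frobeniusForm F).IsHomogeneous (Fintype.card K + (d - 1)) :=
  IsHomogeneous.sum _ _ _ fun i _ =>
    (isHomogeneous_X_pow i _).mul (hF.pderiv (i := i))

theorem dirDeriv_pow_card (v : Fin 3 → K) (G : MvPolynomial (Fin 3) K) :
    dirDeriv v (G ^ Fintype.card K) = 0 := by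
  have h : (Fintype.card K : MvPolynomial (Fin 3) K) = 0 := by
    rw [← map_natCast (C : K →+* _), FiniteField.cast_card_eq_zero, map_zero]
  simp [dirDeriv, Derivation.leibniz_pow, h]

/-- At a rational point, `frobeniusForm F` vanishes to second order in the tangent directions. -/
theorem jet_frobeniusForm {F : MvPolynomial (Fin 3) K} {d : ℕ} (hF : F.IsHomogeneous d)
    {x v : Fin 3 → K} (h : jet x v F = 0) : jet x v (frobeniusForm F) = 0 := by
  have h1 : eval x F = 0 := congrArg Prod.fst h
  have h2 : eval x (dirDeriv v F) = 0 := congrArg Prod.snd h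
  have e1 := congrArg (eval x) hF.sum_X_mul_pderiv
  have e2 := congrArg (eval x) (hF.dirDeriv v).sum_X_mul_pderiv
  simp only [map_sum, map_mul, eval_X, map_nsmul, h1, h2, smul_zero] at e1 e2
  rw [frobeniusForm, map_sum]
  have : ∀ i, jet x v (X i ^ Fintype.card K * pderiv i F) =
      (x i * eval x (pderiv i F), x i * eval x (pderiv i (dirDeriv v F))) := by
    intro i
    simp [jet, dirDeriv_mul, dirDeriv_pow_card, dirDeriv_pderiv, FiniteField.pow_card]
  simp_rw [this]
  exact Prod.ext (by rw [Prod.fst_sum]; exact e1) (by rw [Prod.snd_sum]; exact e2)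

/-- The restriction of `frobeniusForm F` to a rational line, where Frobenius acts on the
parameter only. -/
theorem lineRestriction_frobeniusForm {F : MvPolynomial (Fin 3) K} {d : ℕ}
    (hF : F.IsHomogeneous d) (u v : Fin 3 → K) :
    lineRestriction (frobeniusForm F) u v =
      (Polynomial.X ^ Fintype.card K - Polynomial.X) *
        Polynomial.derivative (lineRestriction F u v) +
          (d : Polynomial K) * lineRestriction F u v := by
  rw [← hF.lineRestriction_euler u v, derivative_lineRestriction]
  have key : ∀ i, (Polynomial.C (u i) * Polynomial.X + Polynomial.C (v i)) ^ Fintype.card K =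
      Polynomial.C (u i) * Polynomial.X ^ Fintype.card K + Polynomial.C (v i) := by
    intro i
    rw [← FiniteField.expand_card]
    simp
  simp only [lineRestriction, frobeniusForm, dirDeriv, map_sum, map_mul, map_pow, aeval_X, key,
    MvPolynomial.algHom_C, Polynomial.algebraMap_eq, Finset.mul_sum, ← Finset.sum_add_distrib]
  refine Finset.sum_congr rfl fun i _ => ?_
  ring

theorem splits_X_pow_card_sub_X :
    (Polynomial.X ^ Fintype.card K - Polynomial.X : Polynomial K).Splits := by
  rw [Polynomial.splits_iff_card_roots, FiniteField.roots_X_pow_card_sub_X,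
    FiniteField.X_pow_card_sub_X_natDegree_eq K Fintype.one_lt_card]
  rfl

/-- A cubic dividing `(t^q - t) g'` either has three distinct rational roots or a multiple rational
root. -/
theorem card_roots_eq_or_exists_double_root [DecidableEq K] {g : Polynomial K}
    (hg : g.natDegree = 3)
    (h : g ∣ (Polynomial.X ^ Fintype.card K - Polynomial.X) * Polynomial.derivative g) :
    g.roots.toFinset.card = 3 ∨ ∃ t, g.eval t = 0 ∧ (Polynomial.derivative g).eval t = 0 := by
  have hg0 : g ≠ 0 := by rintro rfl; simp at hg
  by_cases hsep : g.Separable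
  · left
    have hdvd : g ∣ Polynomial.X ^ Fintype.card K - Polynomial.X :=
      IsCoprime.dvd_of_dvd_mul_right hsep h
    have hs : g.Splits := splits_X_pow_card_sub_X.of_dvd
      (FiniteField.X_pow_card_sub_X_ne_zero K Fintype.one_lt_card) hdvd
    rw [Multiset.toFinset_card_of_nodup (Polynomial.nodup_roots hsep), ← hg,
      Polynomial.splits_iff_card_roots.1 hs]
  · right
    rw [PerfectField.separable_iff_squarefree, Squarefree] at hsep
    push Not at hsep
    -- a multiple factor of a cubic is linear
    obtain ⟨p, ⟨r, hr⟩, hp⟩ := hsep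
    have hp0 : p ≠ 0 := by rintro rfl; simp at hr; exact hg0 hr
    have hr0 : r ≠ 0 := by rintro rfl; simp at hr; exact hg0 hr
    have hdeg : p.natDegree + p.natDegree + r.natDegree = 3 := by
      rw [← hg, hr, Polynomial.natDegree_mul (mul_ne_zero hp0 hp0) hr0,
        Polynomial.natDegree_mul hp0 hp0]
    have hpos : p.natDegree ≠ 0 := fun h0 => hp (by
      rw [Polynomial.isUnit_iff_degree_eq_zero, Polynomial.degree_eq_natDegree hp0, h0]; rfl)
    obtain ⟨t, ht⟩ := Polynomial.exists_root_of_degree_eq_one (p := p) (by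
      rw [Polynomial.degree_eq_natDegree hp0, show p.natDegree = 1 by omega]; rfl)
    rw [Polynomial.IsRoot.def] at ht
    exact ⟨t, by simp [hr, ht], by simp [hr, ht]⟩

/-- If `F` divides `frobeniusForm F`, then every rational line meets the cubic `F = 0`, all of
whose rational points are smooth, in three distinct rational points or is tangent to it at a rational
point. -/
theorem three_le_card_or_tangent [DecidableEq K] {F : MvPolynomial (Fin 3) K}
    (hF : F.IsHomogeneous 3)
    (hq : 3 ≤ Fintype.card K) (hline : HasNoLine F) (hdvd : F ∣ frobeniusForm F)
    (hsmooth : ∀ x, x ≠ 0 → eval x F = 0 → gradient F x ≠ 0)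
    {R : Finset (Fin 3 → K)}
    (hRF : ∀ x ≠ 0, eval x F = 0 → ∃ y ∈ R, ∃ a : K, a ≠ 0 ∧ x = a • y)
    {c : Fin 3 → K} (hc : c ≠ 0) :
    3 ≤ (R.filter fun x => c ⬝ᵥ x = 0).card ∨
      ∃ y ∈ R, c ⬝ᵥ y = 0 ∧ ∃ l : K, c = l • gradient F y := by
  obtain ⟨u, hcu, hu⟩ : ∃ u, c ⬝ᵥ u = 0 ∧ eval u F ≠ 0 := by
    by_contra! hcon
    exact hline c hc (linForm_dvd_of_forall hF hq hc hcon)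
  have hu0 : u ≠ 0 := by
    rintro rfl
    apply hu
    have := hF.eval_smul 0 (0 : Fin 3 → K)
    simpa using this
  obtain ⟨v, hcv, huv⟩ := exists_linearIndependent_of_dotProduct c hu0
  set g := lineRestriction F u v with hg
  have hcoeff : g.coeff 3 ≠ 0 := by rwa [hg, hF.coeff_lineRestriction]
  have hdeg : g.natDegree = 3 :=
    le_antisymm (hF.natDegree_lineRestriction_le u v) (Polynomial.le_natDegree_of_ne_zero hcoeff)
  have hg0 : g ≠ 0 := by rintro h; simp [h] at hcoeff
  have hdvd' : g ∣ (Polynomial.X ^ Fintype.card K - Polynomial.X) * Polynomial.derivative g := by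
    have h1 : g ∣ lineRestriction (frobeniusForm F) u v := by
      obtain ⟨G, hG⟩ := hdvd
      rw [hG, lineRestriction, map_mul]
      exact dvd_mul_right _ _
    rw [lineRestriction_frobeniusForm hF, ← hg] at h1
    exact (dvd_add_left (dvd_mul_left _ _)).1 h1
  have hcx : ∀ t : K, c ⬝ᵥ (t • u + v) = 0 := by
    intro t; rw [dotProduct_add, dotProduct_smul, hcu, hcv]; simp
  rcases card_roots_eq_or_exists_double_root hdeg hdvd' with h3 | ⟨t, ht, ht'⟩
  · left
    refine h3.symm.le.trans ?_
    have hex : ∀ t ∈ g.roots.toFinset, ∃ y ∈ R, ∃ a : K, a ≠ 0 ∧ t • u + v = a • y := by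
      intro t ht
      rw [Multiset.mem_toFinset, Polynomial.mem_roots hg0, Polynomial.IsRoot.def, hg,
        eval_lineRestriction] at ht
      exact hRF _ (smul_add_ne_zero huv t) ht
    choose! y hyR a ha hya using hex
    refine Finset.card_le_card_of_injOn y ?_ ?_
    · intro t ht
      rw [Finset.mem_coe, Finset.mem_filter]
      refine ⟨hyR t ht, ?_⟩
      have := hcx t
      rw [hya t ht, dotProduct_smul, smul_eq_mul] at this
      exact (mul_eq_zero.1 this).resolve_left (ha t ht)
    · intro t ht s hs hts
      have e1 := hya t ht
      have e2 := hya s hs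
      rw [← hts] at e2
      have e3 : (t * a s - s * a t) • u + (a s - a t) • v = 0 := by
        have : a s • (t • u + v) = a t • (s • u + v) := by
          rw [e1, e2, smul_smul, smul_smul, mul_comm]
        rw [← sub_eq_zero] at this
        rw [← this]
        module
      obtain ⟨h1, h2⟩ := (LinearIndependent.pair_iff.1 huv) _ _ e3
      rw [sub_eq_zero] at h1 h2
      rw [h2] at h1
      exact mul_right_cancel₀ (ha t ht) h1
  · right
    rw [hg, eval_lineRestriction] at ht
    rw [hg, derivative_lineRestriction, eval_lineRestriction, eval_dirDeriv] at ht'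
    have hx0 := smul_add_ne_zero huv t
    have hgx : gradient F (t • u + v) ⬝ᵥ v = 0 := by
      have := hF.gradient_dotProduct_self (t • u + v)
      rw [ht, dotProduct_add, dotProduct_smul, ht'] at this
      simpa using this
    obtain ⟨l, hl⟩ := exists_smul_eq_of_dotProduct_eq_zero huv (hsmooth _ hx0 ht) ht' hgx hcu hcv
    obtain ⟨y, hyR, a, ha, hya⟩ := hRF _ hx0 ht
    refine ⟨y, hyR, ?_, l * a ^ 2, ?_⟩
    · have := hcx t
      rw [hya, dotProduct_smul, smul_eq_mul] at this
      exact (mul_eq_zero.1 this).resolve_left ha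
    · rw [hl, hya, hF.gradient_smul, smul_smul]

theorem exists_representatives_zeros [DecidableEq K] (F : MvPolynomial (Fin 3) K) {d : ℕ}
    (hF : F.IsHomogeneous d) :
    ∃ R : Finset (Fin 3 → K), RepresentsDistinctPoints R ∧ (∀ x ∈ R, eval x F = 0) ∧
      ∀ x ≠ 0, eval x F = 0 → ∃ y ∈ R, ∃ a : K, a ≠ 0 ∧ x = a • y := by
  classical
  have := Fintype.ofFinite (Projectivization K (Fin 3 → K))
  refine ⟨(Finset.univ.image (Projectivization.rep (K := K) (V := Fin 3 → K))).filter
    fun x => eval x F = 0, ⟨?_, ?_⟩, ?_, ?_⟩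
  · intro x hx
    obtain ⟨P, -, rfl⟩ := Finset.mem_image.1 (Finset.mem_filter.1 hx).1
    exact P.rep_nonzero
  · intro x hx y hy hxy
    obtain ⟨P, -, rfl⟩ := Finset.mem_image.1 (Finset.mem_filter.1 hx).1
    obtain ⟨Q, -, rfl⟩ := Finset.mem_image.1 (Finset.mem_filter.1 hy).1
    rw [LinearIndependent.pair_iff' P.rep_nonzero]
    intro a ha
    apply hxy
    have h := (Projectivization.mk_eq_mk_iff' K _ _ Q.rep_nonzero P.rep_nonzero).2 ⟨a, ha⟩
    rw [Q.mk_rep, P.mk_rep] at h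
    rw [h]
  · intro x hx; exact (Finset.mem_filter.1 hx).2
  · intro x hx hFx
    obtain ⟨a, ha⟩ := Projectivization.exists_smul_eq_mk_rep K x hx
    refine ⟨_, Finset.mem_filter.2 ⟨Finset.mem_image.2
      ⟨Projectivization.mk K x hx, Finset.mem_univ _, rfl⟩, ?_⟩, (a⁻¹ : Kˣ), Units.ne_zero _, ?_⟩
    · rw [← ha, Units.smul_def, hF.eval_smul, hFx, mul_zero]
    · rw [← ha, ← Units.smul_def, inv_smul_smul]

/-- A cubic without line components whose rational points are smooth, and which has a rational
point, does not divide its Frobenius form. Otherwise the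
number `n` of its rational points, which is at most `2 q + 3`, would be at least
`3 (q² + q + 1) / (q + 3)`, by counting incidences with lines: all but at most `n` lines contain
three of the points. -/
theorem not_dvd_frobeniusForm [DecidableEq K] {F : MvPolynomial (Fin 3) K} (hF : F.IsHomogeneous 3)
    (hq : 7 ≤ Fintype.card K) (hline : HasNoLine F)
    (hsmooth : ∀ x, x ≠ 0 → eval x F = 0 → gradient F x ≠ 0)
    {P : Fin 3 → K} (hP : P ≠ 0) (hFP : eval P F = 0) : ¬ F ∣ frobeniusForm F := by
  intro hdvd
  obtain ⟨R, hR, hRF, hRall⟩ := exists_representatives_zeros F hF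
  have hle := card_le_of_card_zeroVectors_le hR hF hRF (card_zeroVectors_le hF (by omega) hline hP
    (natDegree_lineRestriction_le_of_eval_eq_zero hF hFP))
  set A : Finset (Fin 3 → K) := Finset.univ.erase 0 with hA
  -- the equations of the tangents at the points of `R`
  set T : Finset (Fin 3 → K) :=
    (R ×ˢ (Finset.univ : Finset Kˣ)).image fun p => (p.2 : K) • gradient F p.1 with hT
  have hTcard : T.card ≤ R.card * (Fintype.card K - 1) := by
    refine Finset.card_image_le.trans ?_
    rw [Finset.card_product, Finset.card_univ, Fintype.card_units]
  -- count the pairs of a point and a nonzero equation of a line through it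
  have hcount : ∑ c ∈ A, (R.filter fun x => c ⬝ᵥ x = 0).card =
      R.card * (Fintype.card K ^ 2 - 1) := by
    simp_rw [Finset.card_filter]
    rw [Finset.sum_comm, ← smul_eq_mul, ← Finset.sum_const]
    refine Finset.sum_congr rfl fun x hx => ?_
    rw [← Finset.card_filter, hA, Finset.filter_erase, Finset.card_erase_of_mem (by simp)]
    congr 1
    rw [← card_dotProduct_eq_zero (hR.1 x hx)]
    congr 1
    ext c
    simp [dotProduct_comm]
  have hlow : ∀ c ∈ A, 3 ≤ (R.filter fun x => c ⬝ᵥ x = 0).card + (if c ∈ T then 2 else 0) := by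
    intro c hc
    have hc0 : c ≠ 0 := (Finset.mem_erase.1 hc).1
    rcases three_le_card_or_tangent hF (by omega) hline hdvd hsmooth hRall hc0 with h | h
    · omega
    · obtain ⟨y, hyR, hcy, l, hl⟩ := h
      have hl0 : l ≠ 0 := by rintro rfl; simp at hl; exact hc0 hl
      have hmem : c ∈ T := Finset.mem_image.2
        ⟨(y, Units.mk0 l hl0), Finset.mem_product.2 ⟨hyR, Finset.mem_univ _⟩, hl.symm⟩
      have h1 : 0 < (R.filter fun x => c ⬝ᵥ x = 0).card :=
        Finset.card_pos.2 ⟨y, Finset.mem_filter.2 ⟨hyR, hcy⟩⟩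
      rw [if_pos hmem]
      omega
  have hsum := Finset.sum_le_sum hlow
  rw [Finset.sum_add_distrib, hcount, Finset.sum_const, smul_eq_mul] at hsum
  have hT2 : ∑ c ∈ A, (if c ∈ T then 2 else 0) ≤ 2 * T.card := by
    rw [← Finset.sum_filter, Finset.sum_const, smul_eq_mul, mul_comm]
    exact Nat.mul_le_mul_left _ (Finset.card_le_card fun c hc => (Finset.mem_filter.1 hc).2)
  have hAcard : A.card = Fintype.card K ^ 3 - 1 := by
    rw [hA, Finset.card_erase_of_mem (Finset.mem_univ _), Finset.card_univ, Fintype.card_fun,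
      Fintype.card_fin]
  obtain ⟨r, hr⟩ : ∃ r, Fintype.card K = r + 7 := ⟨_, (Nat.sub_add_cancel hq).symm⟩
  have e1 : Fintype.card K - 1 = r + 6 := by omega
  have e2 : Fintype.card K ^ 2 - 1 = (r + 6) * (r + 8) := by
    rw [hr]; refine Nat.sub_eq_of_eq_add ?_; ring
  have e3 : Fintype.card K ^ 3 - 1 = (r + 6) * (r ^ 2 + 15 * r + 57) := by
    rw [hr]; refine Nat.sub_eq_of_eq_add ?_; ring
  rw [e1] at hTcard
  rw [hAcard, e3, e2] at hsum
  rw [hr] at hle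
  have h5 : (r + 6) * (3 * (r ^ 2 + 15 * r + 57)) ≤ (r + 6) * (R.card * (r + 10)) := by
    nlinarith
  have h6 := Nat.le_of_mul_le_mul_left h5 (by omega)
  nlinarith

/-- A cubic without line components has at most `(3 q + 6) / 2` rational points. -/
theorem two_mul_card_le_of_cubic [DecidableEq K] {S : Finset (Fin 3 → K)}
    (hS : RepresentsDistinctPoints S)
    {F : MvPolynomial (Fin 3) K} (hF : F.IsHomogeneous 3) (hq : 7 ≤ Fintype.card K)
    (hline : HasNoLine F) (h : ∀ x ∈ S, eval x F = 0) :
    2 * S.card ≤ 3 * Fintype.card K + 6 := by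
  rcases S.eq_empty_or_nonempty with rfl | ⟨P, hP⟩
  · simp
  by_cases hsmooth : ∀ x, x ≠ 0 → eval x F = 0 → gradient F x ≠ 0
  · have hnd := not_dvd_frobeniusForm hF hq hline hsmooth (hS.1 P hP) (h P hP)
    have hex : ∀ x ∈ S, ∃ v, gradient F x ⬝ᵥ v = 0 ∧ LinearIndependent K ![x, v] :=
      fun x hx => exists_linearIndependent_of_dotProduct _ (hS.1 x hx)
    choose! v hv hxv using hex
    have hjet : ∀ x ∈ S, jet x (v x) F = 0 := fun x hx =>
      Prod.ext (h x hx) ((eval_dirDeriv _ _ _).trans (hv x hx))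
    have := two_mul_card_le_mul hF (isHomogeneous_frobeniusForm hF)
      (hline.irreducible_of_cubic hF).prime hnd hS hxv hjet
      fun x hx => jet_frobeniusForm hF (hjet x hx)
    omega
  · push Not at hsmooth
    obtain ⟨x, hx, hFx, hgx⟩ := hsmooth
    have := card_le_of_singular_cubic hS hF (by omega) hline h hx hFx hgx
    omega

end Frobenius

/-! ### The parameters of the codes -/

section Codes

open MvPolynomial

variable {K : Type*} [Field K] [Fintype K] [DecidableEq K]

theorem mem_normalizedPoints {x : Fin 3 → K} : x ∈ normalizedPoints K ↔
    x = ![1, 0, 0] ∨ x 2 = 1 ∧ ZeroOrNonsquare (disc x) := by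
  simp only [normalizedPoints, Finset.mem_insert, Finset.mem_image, Finset.mem_filter,
    Finset.mem_univ, true_and]
  refine or_congr_right ⟨?_, ?_⟩
  · rintro ⟨p, hp, rfl⟩
    exact ⟨rfl, by simpa [disc] using hp⟩
  · rintro ⟨h2, hx⟩
    refine ⟨(x 0, x 1), by simpa [disc, h2] using hx, ?_⟩
    funext i
    fin_cases i <;> simp [h2]

theorem ne_zero_of_mem_normalizedPoints {x : Fin 3 → K} (hx : x ∈ normalizedPoints K) : x ≠ 0 := by
  rintro rfl
  rcases mem_normalizedPoints.1 hx with h | ⟨h, -⟩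
  · simpa using congrFun h 0
  · simp at h

theorem zeroOrNonsquare_of_mem_normalizedPoints {x : Fin 3 → K} (hx : x ∈ normalizedPoints K) :
    ZeroOrNonsquare (disc x) := by
  rcases mem_normalizedPoints.1 hx with rfl | ⟨-, h⟩
  · left; simp [disc]
  · exact h

theorem representsDistinctPoints_normalizedPoints :
    RepresentsDistinctPoints (normalizedPoints K) := by
  refine ⟨fun x hx => ne_zero_of_mem_normalizedPoints hx, fun x hx y hy hxy => ?_⟩
  rw [LinearIndependent.pair_iff' (ne_zero_of_mem_normalizedPoints hx)]
  intro a ha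
  apply hxy
  have h2 := congrFun ha 2
  rcases mem_normalizedPoints.1 hx with rfl | ⟨hx2, -⟩ <;>
    rcases mem_normalizedPoints.1 hy with rfl | ⟨hy2, -⟩
  · rfl
  · simp [hy2] at h2
  · have : a = 0 := by simpa [hx2] using h2
    simpa [this] using congrFun ha 0
  · have : a = 1 := by simpa [hx2, hy2] using h2
    rw [← ha, this, one_smul]

theorem exists_smul_mem_normalizedPoints {x : Fin 3 → K} (hx : x ≠ 0)
    (h : ZeroOrNonsquare (disc x)) : ∃ a : K, a ≠ 0 ∧ a • x ∈ normalizedPoints K := by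
  by_cases h2 : x 2 = 0
  · have h1 : x 1 = 0 := by
      rw [disc, h2, mul_zero, sub_zero] at h
      exact zeroOrNonsquare_sq.1 h
    have h0 : x 0 ≠ 0 := by
      intro h0; apply hx; funext i; fin_cases i <;> simpa
    refine ⟨(x 0)⁻¹, inv_ne_zero h0, mem_normalizedPoints.2 (Or.inl ?_)⟩
    funext i
    fin_cases i <;> simp [h0, h1, h2]
  · refine ⟨(x 2)⁻¹, inv_ne_zero h2, mem_normalizedPoints.2 (Or.inr ⟨by simp [h2], ?_⟩)⟩
    rwa [disc_smul, zeroOrNonsquare_sq_mul (inv_ne_zero h2)]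

/-- A homogeneous condition can be counted on any choice of coordinate vectors. -/
theorem card_filter_rationalPoints (hodd : Odd (Fintype.card K))
    {r : rationalPoints K → {v : Fin 3 → K // v ≠ 0}} (hr : IsRepresentatives r)
    (p : (Fin 3 → K) → Prop) [DecidablePred p] (hp : ∀ a : K, a ≠ 0 → ∀ x, p (a • x) ↔ p x) :
    (Finset.univ.filter fun P : rationalPoints K => p (r P).1).card =
      ((normalizedPoints K).filter p).card := by
  have hscale : ∀ (P : rationalPoints K) (x : Fin 3 → K) (hx : x ≠ 0),
      Projectivization.mk K x hx = P.1 → ∃ a : K, a ≠ 0 ∧ a • x = (r P).1 := by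
    intro P x hx h
    rw [← hr P, eq_comm, Projectivization.mk_eq_mk_iff] at h
    obtain ⟨a, ha⟩ := h
    exact ⟨a, a.ne_zero, ha⟩
  symm
  refine Finset.card_bij (fun x hx =>
    ⟨Projectivization.mk K x (ne_zero_of_mem_normalizedPoints (Finset.mem_filter.1 hx).1),
      (mk_mem_rationalPoints_iff hodd _).2
        (zeroOrNonsquare_of_mem_normalizedPoints (Finset.mem_filter.1 hx).1)⟩) ?_ ?_ ?_
  · intro x hx
    rw [Finset.mem_filter]
    refine ⟨Finset.mem_univ _, ?_⟩
    obtain ⟨a, ha, hax⟩ := hscale ⟨Projectivization.mk K x _, (mk_mem_rationalPoints_iff hodd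
      (ne_zero_of_mem_normalizedPoints (Finset.mem_filter.1 hx).1)).2
        (zeroOrNonsquare_of_mem_normalizedPoints (Finset.mem_filter.1 hx).1)⟩ x _ rfl
    rw [← hax, hp a ha]
    exact (Finset.mem_filter.1 hx).2
  · intro x hx y hy hxy
    by_contra hne
    have h := representsDistinctPoints_normalizedPoints.2 x (Finset.mem_filter.1 hx).1 y
      (Finset.mem_filter.1 hy).1 hne
    have h' := congrArg Subtype.val hxy
    simp only at h'
    rw [eq_comm, Projectivization.mk_eq_mk_iff'] at h'
    obtain ⟨a, ha⟩ := h'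
    exact (LinearIndependent.pair_iff'
      (ne_zero_of_mem_normalizedPoints (Finset.mem_filter.1 hx).1)).1 h a ha
  · intro P hP
    have hQ : ZeroOrNonsquare (disc (r P).1) := by
      rw [← mk_mem_rationalPoints_iff hodd (r P).2, hr P]
      exact P.2
    obtain ⟨a, ha, hmem⟩ := exists_smul_mem_normalizedPoints (r P).2 hQ
    refine ⟨a • (r P).1, Finset.mem_filter.2 ⟨hmem, (hp a ha _).2 (Finset.mem_filter.1 hP).2⟩,
      Subtype.ext ?_⟩
    change Projectivization.mk K _ _ = P.1
    rw [← hr P, Projectivization.mk_eq_mk_iff']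
    exact ⟨a, rfl⟩

theorem two_mul_card_rationalPoints (hodd : Odd (Fintype.card K))
    {r : rationalPoints K → {v : Fin 3 → K // v ≠ 0}} (hr : IsRepresentatives r) :
    2 * Fintype.card (rationalPoints K) = Fintype.card K ^ 2 + Fintype.card K + 2 := by
  have h := card_filter_rationalPoints hodd hr (fun _ => True) (fun _ _ _ => Iff.rfl)
  rw [Finset.filter_true, Finset.filter_true, Finset.card_univ] at h
  rw [h, two_mul_card_normalizedPoints hodd]

/-- The number of rational points of the Ballico-Hefez curve at which the form `F` vanishes. -/
noncomputable def zeroCount (F : MvPolynomial (Fin 3) K) : ℕ :=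
  ((normalizedPoints K).filter fun x => eval x F = 0).card

theorem zeroCount_mul_le (F G : MvPolynomial (Fin 3) K) :
    zeroCount (F * G) ≤ zeroCount F + zeroCount G := by
  refine (Finset.card_le_card ?_).trans (Finset.card_union_le _ _)
  intro x hx
  simpa [← and_or_left] using hx

theorem two_mul_zeroCount_line_le (hodd : Odd (Fintype.card K)) {F : MvPolynomial (Fin 3) K}
    (hF : F.IsHomogeneous 1) (hF0 : F ≠ 0) : 2 * zeroCount F ≤ Fintype.card K + 3 := by
  obtain ⟨c, rfl⟩ := hF.exists_eq_linForm
  have hc : c ≠ 0 := by rintro rfl; exact hF0 (by simp [linForm])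
  have h := two_mul_card_line_le hodd hc
  simpa only [zeroCount, eval_linForm] using h

theorem representsDistinctPoints_zeros (F : MvPolynomial (Fin 3) K) :
    RepresentsDistinctPoints ((normalizedPoints K).filter fun x => eval x F = 0) :=
  representsDistinctPoints_normalizedPoints.mono (Finset.filter_subset _ _)

theorem two_mul_zeroCount_conic_le (hodd : Odd (Fintype.card K)) {F : MvPolynomial (Fin 3) K}
    (hF : F.IsHomogeneous 2) (hF0 : F ≠ 0) : 2 * zeroCount F ≤ 2 * (Fintype.card K + 3) := by
  rcases hasNoLine_or_exists_eq_mul hF hF0 with h | ⟨L, G, hL, hL0, hG, hG0, rfl⟩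
  · have := card_le_of_conic (representsDistinctPoints_zeros F) hF h
      fun x hx => (Finset.mem_filter.1 hx).2
    rw [← zeroCount] at this
    omega
  · have h1 := two_mul_zeroCount_line_le hodd hL hL0
    have h2 := two_mul_zeroCount_line_le hodd hG hG0
    have h3 := zeroCount_mul_le L G
    omega

theorem two_mul_zeroCount_cubic_le (hodd : Odd (Fintype.card K)) (hq : 7 ≤ Fintype.card K)
    {F : MvPolynomial (Fin 3) K} (hF : F.IsHomogeneous 3) (hF0 : F ≠ 0) :
    2 * zeroCount F ≤ 3 * (Fintype.card K + 3) := by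
  rcases hasNoLine_or_exists_eq_mul hF hF0 with h | ⟨L, G, hL, hL0, hG, hG0, rfl⟩
  · have := two_mul_card_le_of_cubic (representsDistinctPoints_zeros F) hF hq h
      fun x hx => (Finset.mem_filter.1 hx).2
    rw [← zeroCount] at this
    omega
  · have h1 := two_mul_zeroCount_line_le hodd hL hL0
    have h2 := two_mul_zeroCount_conic_le hodd hG hG0
    have h3 := zeroCount_mul_le L G
    omega

theorem exists_finset_squares (hodd : Odd (Fintype.card K)) {i : ℕ}
    (hi : 2 * i + 1 ≤ Fintype.card K) :
    ∃ s : Finset K, s.card = i ∧ ∀ c ∈ s, ∃ a : K, a ≠ 0 ∧ a ^ 2 = c := by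
  set A : Finset K := Finset.univ.erase 0 with hA
  have h1 : A.card ≤ 2 * (A.image fun a => a ^ 2).card := by
    refine Finset.card_le_mul_card_image A 2 fun c _ => ?_
    have h2 : (A.filter fun a => a ^ 2 = c).card ≤
        (Finset.univ.filter fun a : K => a ^ 2 = c).card :=
      Finset.card_le_card (Finset.filter_subset_filter _ (Finset.subset_univ _))
    have h3 := card_sq_eq hodd c
    have h4 := quadraticChar_le_one c
    omega
  rw [hA, Finset.card_erase_of_mem (Finset.mem_univ _), Finset.card_univ, ← hA] at h1
  obtain ⟨s, hs, hcard⟩ := Finset.exists_subset_card_eq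
    (show i ≤ (A.image fun a => a ^ 2).card by omega)
  refine ⟨s, hcard, fun c hc => ?_⟩
  obtain ⟨a, ha, hac⟩ := Finset.mem_image.1 (hs hc)
  exact ⟨a, (Finset.mem_erase.1 ha).1, hac⟩

/-- The bound `i (q + 3) / 2` for the number of zeros is attained by the product of `i` secants of
the conic `x₁² = 4 x₀ x₂` through the point `(0 : 1 : 0)`, which does not lie on the curve. -/
theorem exists_two_mul_zeroCount_eq (hodd : Odd (Fintype.card K)) {i : ℕ}
    (hi : 2 * i + 1 ≤ Fintype.card K) : ∃ F : MvPolynomial (Fin 3) K, F.IsHomogeneous i ∧ F ≠ 0 ∧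
      2 * zeroCount F = i * (Fintype.card K + 3) := by
  obtain ⟨s, hs, hsq⟩ := exists_finset_squares hodd hi
  refine ⟨∏ c ∈ s, linForm ![1, 0, -c], ?_, ?_, ?_⟩
  · have := IsHomogeneous.prod s (fun c => linForm ![(1 : K), 0, -c]) (fun _ => 1)
      fun c _ => isHomogeneous_linForm _
    simpa [hs] using this
  · refine Finset.prod_ne_zero_iff.2 fun c _ => linForm_ne_zero fun h => ?_
    simpa using congrFun h 0
  · have hset : ((normalizedPoints K).filter fun x => eval x (∏ c ∈ s, linForm ![1, 0, -c]) = 0) =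
        s.biUnion fun c => (normalizedPoints K).filter fun x => ![1, 0, -c] ⬝ᵥ x = 0 := by
      ext x
      simp only [Finset.mem_filter, Finset.mem_biUnion, map_prod, eval_linForm,
        Finset.prod_eq_zero_iff]
      tauto
    rw [zeroCount, hset, Finset.card_biUnion, Finset.mul_sum, ← hs, ← smul_eq_mul (s.card),
      ← Finset.sum_const]
    · refine Finset.sum_congr rfl fun c hc => ?_
      obtain ⟨a, ha, rfl⟩ := hsq c hc
      exact two_mul_card_secant hodd ha
    · intro c _ d _ hcd
      rw [Function.onFun, Finset.disjoint_left]
      intro x hxc hxd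
      rw [Finset.mem_filter] at hxc hxd
      have e1 := hxc.2
      have e2 := hxd.2
      simp only [dotProduct, Fin.sum_univ_three, Matrix.cons_val_zero, Matrix.cons_val_one,
        Matrix.cons_val, one_mul, zero_mul, add_zero] at e1 e2
      have h2 : x 2 = 0 := by
        have : (c - d) * x 2 = 0 := by linear_combination e2 - e1
        exact (mul_eq_zero.1 this).resolve_left (sub_ne_zero.2 hcd)
      rcases mem_normalizedPoints.1 hxc.1 with rfl | ⟨h, -⟩
      · simp at e1
      · rw [h2] at h; exact zero_ne_one h

theorem hammingNorm_add_zeroCount (hodd : Odd (Fintype.card K))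
    {r : rationalPoints K → {v : Fin 3 → K // v ≠ 0}} (hr : IsRepresentatives r)
    {F : MvPolynomial (Fin 3) K} {i : ℕ} (hF : F.IsHomogeneous i) :
    hammingNorm (evaluationMap r F) + zeroCount F = Fintype.card (rationalPoints K) := by
  rw [zeroCount, ← card_filter_rationalPoints hodd hr (fun x => eval x F = 0)
    (fun a ha x => by rw [hF.eval_smul]; simp [ha]), hammingNorm, add_comm]
  exact Finset.card_filter_add_card_filter_not _

/-- The parameters of the code of forms of degree `i`, given a bound on the number of zeros. -/
theorem isLinearCode_evaluationCode (hodd : Odd (Fintype.card K))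
    {r : rationalPoints K → {v : Fin 3 → K // v ≠ 0}} (hr : IsRepresentatives r) {i n d : ℕ}
    (hi : 2 * i + 1 ≤ Fintype.card K)
    (hbound : ∀ F : MvPolynomial (Fin 3) K, F.IsHomogeneous i → F ≠ 0 →
      2 * zeroCount F ≤ i * (Fintype.card K + 3))
    (hn : 2 * n = Fintype.card K ^ 2 + Fintype.card K + 2)
    (hd : d + d + i * (Fintype.card K + 3) = 2 * n) (hd0 : 0 < d) :
    IsLinearCode (evaluationCode r i) n ((i + 2).choose 2) d := by
  have hlen := two_mul_card_rationalPoints hodd hr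
  have hweight : ∀ F : MvPolynomial (Fin 3) K, F.IsHomogeneous i → F ≠ 0 →
      d ≤ hammingNorm (evaluationMap r F) := by
    intro F hF hF0
    have h1 := hbound F hF hF0
    have h2 := hammingNorm_add_zeroCount hodd hr hF
    omega
  refine ⟨by omega, ?_, ?_, ?_⟩
  · have hinj : Function.Injective
        ((evaluationMap r).domRestrict (homogeneousSubmodule (Fin 3) K i)) := by
      rw [injective_iff_map_eq_zero]
      rintro ⟨F, hF⟩ h
      by_contra hne
      have h1 := hweight F hF fun h0 => hne (Subtype.ext h0)
      have h2 : evaluationMap r F = 0 := h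
      rw [h2, hammingNorm_zero] at h1
      omega
    rw [← finrank_homogeneousSubmodule (K := K) i, ← LinearMap.finrank_range_of_inj hinj,
      LinearMap.range_domRestrict, evaluationCode]
  · obtain ⟨F, hF, hF0, hFz⟩ := exists_two_mul_zeroCount_eq hodd hi
    have h2 := hammingNorm_add_zeroCount hodd hr hF
    have h3 : hammingNorm (evaluationMap r F) = d := by omega
    refine ⟨evaluationMap r F, ⟨F, hF, rfl⟩, 0, Submodule.zero_mem _, ?_, ?_⟩
    · intro h
      rw [h, hammingNorm_zero] at h3
      omega
    · rw [hammingDist_zero_right, h3]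
  · rintro m ⟨_, ⟨F, hF, rfl⟩, _, ⟨G, hG, rfl⟩, hne, rfl⟩
    rw [hammingDist_eq_hammingNorm, neg_add_eq_sub, ← map_sub]
    refine hweight _ (IsHomogeneous.sub hG hF) fun h => hne ?_
    rw [sub_eq_zero.1 h]

end Codes

end BallicoHefez

/-- The divisions by `2` are exact and the subtractions do not truncate, as `q` is odd and in the
stated range. -/
theorem mainTheorem9 {K : Type*} [Field K] [Fintype K] [DecidableEq K] (q : ℕ)
    (hcard : Fintype.card K = q) (hodd : Odd q)
    (r : BallicoHefez.rationalPoints K → {v : Fin 3 → K // v ≠ 0}) (hr : IsRepresentatives r) :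
    (IsLinearCode (evaluationCode r 1) ((q ^ 2 + q + 2) / 2) 3 ((q ^ 2 - 1) / 2) ∧
      MeetsGriesmerBound (evaluationCode r 1)) ∧
    (5 ≤ q →
      IsLinearCode (evaluationCode r 2) ((q ^ 2 + q + 2) / 2) 6 ((q ^ 2 - q - 4) / 2)) ∧
    (7 ≤ q →
      IsLinearCode (evaluationCode r 3) ((q ^ 2 + q + 2) / 2) 10 ((q ^ 2 - 2 * q - 7) / 2)) := by
  subst hcard
  have hq1 : 1 < Fintype.card K := Fintype.one_lt_card
  obtain ⟨k, hk⟩ := hodd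
  have hsq : Fintype.card K ^ 2 = 4 * k ^ 2 + 4 * k + 1 := by rw [hk]; ring
  have hk2 : k ≤ k ^ 2 := Nat.le_self_pow two_ne_zero k
  have hodd : Odd (Fintype.card K) := ⟨k, hk⟩
  have h1 : IsLinearCode (evaluationCode r 1)
      ((Fintype.card K ^ 2 + Fintype.card K + 2) / 2) 3 ((Fintype.card K ^ 2 - 1) / 2) :=
    BallicoHefez.isLinearCode_evaluationCode hodd hr (by omega)
      (fun F hF hF0 => by rw [one_mul]; exact BallicoHefez.two_mul_zeroCount_line_le hodd hF hF0)
      (by omega) (by omega) (by omega)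
  refine ⟨⟨h1, _, _, _, h1, ?_⟩, fun hq => ?_, fun hq => ?_⟩
  · have hn : (Fintype.card K ^ 2 + Fintype.card K + 2) / 2 = 2 * k ^ 2 + 3 * k + 2 := by omega
    have hd : (Fintype.card K ^ 2 - 1) / 2 = 2 * k ^ 2 + 2 * k := by omega
    have hk1 : (1 : ℚ) ≤ k := by exact_mod_cast (by omega : 1 ≤ k)
    have hqq : (Fintype.card K : ℚ) = 2 * k + 1 := by rw [hk]; push_cast; ring
    have c0 : ⌈((2 * k ^ 2 + 2 * k : ℕ) : ℚ) / (Fintype.card K : ℚ) ^ 0⌉₊ = 2 * k ^ 2 + 2 * k := by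
      rw [pow_zero, div_one, Nat.ceil_natCast]
    have c1 : ⌈((2 * k ^ 2 + 2 * k : ℕ) : ℚ) / (Fintype.card K : ℚ) ^ 1⌉₊ = k + 1 := by
      rw [Nat.ceil_eq_iff (by omega), hqq, pow_one, lt_div_iff₀ (by positivity),
        div_le_iff₀ (by positivity)]
      push_cast
      constructor <;> nlinarith
    have c2 : ⌈((2 * k ^ 2 + 2 * k : ℕ) : ℚ) / (Fintype.card K : ℚ) ^ 2⌉₊ = 1 := by
      rw [Nat.ceil_eq_iff (by omega), hqq, lt_div_iff₀ (by positivity),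
        div_le_iff₀ (by positivity)]
      push_cast
      constructor <;> nlinarith
    rw [hn, hd, Finset.sum_range_succ, Finset.sum_range_succ, Finset.sum_range_one, c0, c1, c2]
    omega
  · have h5 : 5 * Fintype.card K ≤ Fintype.card K ^ 2 := by nlinarith
    exact BallicoHefez.isLinearCode_evaluationCode hodd hr (by omega)
      (fun F hF hF0 => BallicoHefez.two_mul_zeroCount_conic_le hodd hF hF0) (by omega) (by omega) (by omega)
  · have h7 : 7 * Fintype.card K ≤ Fintype.card K ^ 2 := by nlinarith
    exact BallicoHefez.isLinearCode_evaluationCode hodd hr (by omega)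
      (fun F hF hF0 => BallicoHefez.two_mul_zeroCount_cubic_le hodd hq hF hF0) (by omega) (by omega) (by omega)
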